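/- An arrow presentation $\mathbb{G}$ is a finite set of circles (its vertices) carrying finitely many pairwise disjoint arrows (directed arcs), together with a set $E(\mathbb{G})$ of labels, called edges, such that each edge labels exactly two arrows; it represents the ribbon graph obtained by filling each circle with a disc and attaching, for each edge, a band along its two arrows. Let $e$ be an edge with arrows $\overrightarrow{p_1p_2}$ and $\overrightarrow{q_1q_2}$. The deletion $\mathbb{G}\setminus e$ removes the two arrows, but not the circle arcs under them. The contraction $\mathbb{G}/e$ removes the two arrows together with the interiors of the arcs under them and then identifies $p_1$ with $q_2$ and $p_2$ with $q_1$. The edge $e$ is a loop if its two arrows lie on the same circle. A coupling of an edge $f$ of $\mathbb{G}$ with an edge $e$ of $\mathbb{H}$ is a bijection from the two arrows of $f$ to the two arrows of $e$. Given an edge $e$ of $\mathbb{H}$ and a coupling $\varphi_f$ of $f$ with $e$ for every $f\in E(\mathbb{G})$, the tensor product $\mathbb{G}\otimes_{\boldsymbol\varphi}\mathbb{H}$ is obtained by taking, for every $f\in E(\mathbb{G})$, a separate copy $\mathbb{H}^{(f)}$ of $\mathbb{H}$ and forming the 2-sum at $f$: if $\varphi_f$ sends $\overrightarrow{p_1p_2}\mapsto\overrightarrow{q_1q_2}$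 and $\overrightarrow{p_3p_4}\mapsto\overrightarrow{q_3q_4}$, the four arrows and the interiors of the arcs under them are removed and $p_i$ is identified with $q_i$ for $i=1,\dots,4$. Its edges are the pairs $(f,h)$ with $f\in E(\mathbb{G})$ and $h\in E(\mathbb{H})\setminus\{e\}$. For a family $\mathbf b=(b_h)_{h\in E(\mathbb{G})}$ the multivariate Bollobás–Riordan polynomial is $$\tilde{\mathbf Z}(\mathbb{G};a,\mathbf b,c)=\sum_{A\subseteq E(\mathbb{G})}a^{k(A)}\Big(\prod_{h\in A}b_h\Big)c^{b(A)},$$ where $k(A)$ and $b(A)$ are the numbers of connected components and of boundary components of the spanning ribbon subgraph with edge set $A$. **Theorem.** Let $\mathbb{G}$ be an arrow presentation of an orientable ribbon graph, let $\mathbb{H}$ be an arrow presentation of a plane ribbon graph (Euler genus $0$, not necessarily connected), let $e$ be an edge of $\mathbb{H}$ that is not a loop, and for each $f\in E(\mathbb{G})$ let $\varphi_f$ be a coupling of $f$ and $e$. Let $a$, $c$ and $\mathbf b=(b_{f,h})$, with $f\in E(\mathbb{G})$ and $h\in E(\mathbb{H})\setminus\{e\}$, be elements of a field with $a\neq0$,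 $c\neq0$, $ac^2\ne1$, and put $\mathbf b^{(f)}=(b_{f,h})_{h}$. Then for each $f\in E(\mathbb{G})$ the system $$ac\,g_f+f_f=\tilde{\mathbf Z}(\mathbb{H}\setminus e;a,\mathbf b^{(f)},c),\qquad g_f+c\,f_f=\tilde{\mathbf Z}(\mathbb{H}/e;a,\mathbf b^{(f)},c)$$ has a unique solution $(f_f,g_f)$. If $a$ and $c$ are algebraically independent over the subring generated by the $b_{f,h}$ (in particular, if $a$, $c$ and all $b_{f,h}$ are independent indeterminates), then every $g_f$ is nonzero. Whenever all $g_f$ are nonzero, $$\tilde{\mathbf Z}(\mathbb{G}\otimes_{\boldsymbol\varphi}\mathbb{H};a,\mathbf b,c)=(ac)^{-|E(\mathbb{G})|}\Big(\prod_{f\in E(\mathbb{G})}g_f\Big)\,\tilde{\mathbf Z}\big(\mathbb{G};a,(f_f/g_f)_{f\in E(\mathbb{G})},c\big).$$ -/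

import Mathlib

/-- Regluing along a family of points: the points `q i` are re-paired according to `τ`
(the point `q i` is matched with `q (τ i)`), and all other points keep their old partner. -/
noncomputable def reglue {ι P : Type*} (q : ι → P) (τ : ι → ι) (seg : P → P) : P → P :=
  Function.extend q (fun i => q (τ i)) seg

theorem reglue_apply {ι P : Type*} {q : ι → P} (hq : Function.Injective q) (τ : ι → ι)
    (seg : P → P) (i : ι) : reglue q τ seg (q i) = q (τ i) :=
  hq.extend_apply _ _ i

theorem reglue_of_not_mem {ι P : Type*} {q : ι → P} (τ : ι → ι) (seg : P → P) {x : P}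
    (hx : x ∉ Set.range q) : reglue q τ seg x = seg x :=
  Function.extend_apply' _ _ _ hx

theorem reglue_involutive {ι P : Type*} {q : ι → P} (hq : Function.Injective q) {τ : ι → ι}
    (hτ : Function.Involutive τ) {seg : P → P} (hs : Function.Involutive seg)
    (hr : ∀ i, seg (q i) ∈ Set.range q) : Function.Involutive (reglue q τ seg) := by
  intro x
  by_cases hx : x ∈ Set.range q
  · obtain ⟨i, rfl⟩ := hx
    rw [reglue_apply hq, reglue_apply hq, hτ]
  · have hx' : seg x ∉ Set.range q := by
      rintro ⟨i, hi⟩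
      exact hx (by have := hr i; rwa [hi, hs] at this)
    rw [reglue_of_not_mem τ seg hx, reglue_of_not_mem τ seg hx', hs]

theorem reglue_ne {ι P : Type*} {q : ι → P} (hq : Function.Injective q) {τ : ι → ι}
    (hτ : ∀ i, τ i ≠ i) {seg : P → P} (hs : ∀ x, seg x ≠ x) (x : P) :
    reglue q τ seg x ≠ x := by
  by_cases hx : x ∈ Set.range q
  · obtain ⟨i, rfl⟩ := hx
    rw [reglue_apply hq]
    exact fun h => hτ i (hq h)
  · rw [reglue_of_not_mem τ seg hx]
    exact hs x

/-- An arrow presentation with edge set `E`.  `P` is a set of marked points on a collection of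
circles (at least two on each circle).  The marked points cut the circles into intervals, which are
alternately called *arcs* and *segments*: `arc x` (resp. `seg x`) is the other end of the arc
(resp. segment) that starts at `x`.  Thus the circles are the orbits of the two involutions.

Every arrow covers exactly one segment, and a segment carries at most one arrow (segments without an
arrow and circles without arrows are allowed).  Each edge `e` labels exactly two arrows, the arrows
`(e, false)` and `(e, true)`; the arrow `(e, i)` points from its tail `pt (e, i, false)` to its
head `pt (e, i, true)`. -/
structure ArrowPresentation (E P : Type*) where
  arc : P → P
  seg : P → P
  arc_involutive : Function.Involutive arc
  seg_involutive : Function.Involutive seg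
  arc_ne : ∀ x, arc x ≠ x
  seg_ne : ∀ x, seg x ≠ x
  pt : E × Bool × Bool → P
  pt_injective : Function.Injective pt
  seg_pt : ∀ e i t, seg (pt (e, i, t)) = pt (e, i, !t)

namespace ArrowPresentation

/-- The vertices are the circles. -/
def Vertex {E P : Type*} (G : ArrowPresentation E P) : Type _ :=
  Quot fun x y : P => y = G.arc x ∨ y = G.seg x

/-- The vertex on which a marked point lies. -/
def vertexOf {E P : Type*} (G : ArrowPresentation E P) (x : P) : G.Vertex := Quot.mk _ x

/-- An edge is a loop if its two arrows lie on the same vertex. -/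
def IsLoop {E P : Type*} (G : ArrowPresentation E P) (e : E) : Prop :=
  G.vertexOf (G.pt (e, false, false)) = G.vertexOf (G.pt (e, true, false))

/-- The connected components: two points are in the same component if they can be joined by moving
along circles and by passing from one arrow of an edge to the other. -/
def Component {E P : Type*} (G : ArrowPresentation E P) : Type _ :=
  Quot fun x y : P => y = G.arc x ∨ y = G.seg x ∨
    ∃ e t, x = G.pt (e, false, t) ∧ y = G.pt (e, true, t)

/-- The curves that replace the segments in the boundary: for every edge with arrows `p₁p₂` and
`q₁q₂`, the two segments under the arrows are removed and replaced by a curve from `p₁` to `q₂` and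
a curve from `p₂` to `q₁`. -/
noncomputable def boundarySeg {E P : Type*} (G : ArrowPresentation E P) : P → P :=
  reglue G.pt (fun s => (s.1, !s.2.1, !s.2.2)) G.seg

/-- The boundary components. -/
def Boundary {E P : Type*} (G : ArrowPresentation E P) : Type _ :=
  Quot fun x y : P => y = G.arc x ∨ y = G.boundarySeg x

/-- Number of vertices. -/
noncomputable def numVertices {E P : Type*} (G : ArrowPresentation E P) : ℕ := Nat.card G.Vertex

/-- Number of connected components. -/
noncomputable def numComponents {E P : Type*} (G : ArrowPresentation E P) : ℕ :=
  Nat.card G.Component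

/-- Number of boundary components. -/
noncomputable def numBoundary {E P : Type*} (G : ArrowPresentation E P) : ℕ := Nat.card G.Boundary

/-- The ribbon graph is plane: the closed surface obtained by capping off its boundary components
consists of spheres, i.e. `v - e + b = 2k`.  Connectedness is not demanded. -/
def Plane {E P : Type*} (G : ArrowPresentation E P) : Prop :=
  G.numVertices + G.numBoundary = 2 * G.numComponents + Nat.card E

/-- The ribbon graph is orientable: all circles can be directed so that for each edge either both
its arrows agree with, or both disagree with, the directions of the circles they lie on.
A direction of the circles is a two-colouring `o` of the marked points that alternates along the
circles: `o x = true` means that the direction runs from `x` along the segment at `x`. -/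
def Orientable {E P : Type*} (G : ArrowPresentation E P) : Prop :=
  ∃ o : P → Bool, (∀ x, o (G.arc x) = !o x) ∧ (∀ x, o (G.seg x) = !o x) ∧
    ∀ e, o (G.pt (e, false, false)) = o (G.pt (e, true, false))

/-- Delete all edges outside `A`: their arrows are removed, the circles stay. -/
def restrict {E P : Type*} (G : ArrowPresentation E P) (A : Set E) : ArrowPresentation A P where
  arc := G.arc
  seg := G.seg
  arc_involutive := G.arc_involutive
  seg_involutive := G.seg_involutive
  arc_ne := G.arc_ne
  seg_ne := G.seg_ne
  pt s := G.pt (s.1.1, s.2)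
  pt_injective := by
    rintro ⟨⟨e, he⟩, s⟩ ⟨⟨e', he'⟩, s'⟩ h
    simpa using G.pt_injective h
  seg_pt _ _ _ := G.seg_pt _ _ _

/-- The deletion `G \ e`. -/
def delete {E P : Type*} (G : ArrowPresentation E P) (e : E) :
    ArrowPresentation {h : E // h ≠ e} P :=
  G.restrict {h | h ≠ e}

/-- The contraction `G / e`: if `p₁p₂` and `q₁q₂` are the arrows of `e`, remove the arrows together
with the segments they cover, identify `p₁` with `q₂` and `p₂` with `q₁` (here the identified points
are joined by a new segment without arrow), and remove `e` from the edge set. -/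
noncomputable def contract {E P : Type*} (G : ArrowPresentation E P) (e : E) :
    ArrowPresentation {h : E // h ≠ e} P where
  arc := G.arc
  seg := reglue (fun s : Bool × Bool => G.pt (e, s)) (fun s => (!s.1, !s.2)) G.seg
  arc_involutive := G.arc_involutive
  seg_involutive := by
    refine reglue_involutive (fun s s' h => by simpa using G.pt_injective h) (fun s => by simp)
      G.seg_involutive ?_
    rintro ⟨i, t⟩
    exact ⟨(i, !t), (G.seg_pt e i t).symm⟩
  arc_ne := G.arc_ne
  seg_ne := by
    refine reglue_ne (fun s s' h => by simpa using G.pt_injective h) ?_ G.seg_ne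
    rintro ⟨i, t⟩ h
    simp at h
  pt s := G.pt (s.1.1, s.2)
  pt_injective := by
    rintro ⟨⟨e, he⟩, s⟩ ⟨⟨e', he'⟩, s'⟩ h
    simpa using G.pt_injective h
  seg_pt := by
    rintro ⟨h, hh⟩ i t
    rw [reglue_of_not_mem, G.seg_pt]
    rintro ⟨s, hs⟩
    exact hh (congrArg Prod.fst (G.pt_injective hs)).symm

/-- The points that are glued together in a tensor product: for each edge `d` of `G`, arrow `i` of
`d` and end `t` of that arrow, this point of `G`, and the point of the `d`-th copy of `H` which is
the same end of the arrow of `e` that is coupled with `i`. -/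
def tensorPt {E P E' P' : Type*} (G : ArrowPresentation E P) (H : ArrowPresentation E' P') (e : E')
    (φ : E → Equiv.Perm Bool) : (E × Bool × Bool) × Bool → P ⊕ (E × P')
  | (s, false) => Sum.inl (G.pt s)
  | ((d, i, t), true) => Sum.inr (d, H.pt (e, φ d i, t))

theorem tensorPt_injective {E P E' P' : Type*} (G : ArrowPresentation E P)
    (H : ArrowPresentation E' P') (e : E') (φ : E → Equiv.Perm Bool) :
    Function.Injective (G.tensorPt H e φ) := by
  rintro ⟨⟨d, i, t⟩, _ | _⟩ ⟨⟨d', i', t'⟩, _ | _⟩ h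
  · simpa using G.pt_injective (Sum.inl_injective h)
  · simp [tensorPt] at h
  · simp [tensorPt] at h
  · have h1 := Sum.inr_injective h
    obtain rfl : d = d' := congrArg Prod.fst h1
    have h2 := H.pt_injective (congrArg Prod.snd h1)
    simp only [Prod.mk.injEq, true_and, EmbeddingLike.apply_eq_iff_eq] at h2
    simp [h2.1, h2.2]

/-- The tensor product `G ⊗_φ H` along the edge `e` of `H`.  The coupling `φ d` is a bijection from
the two arrows of `d` to the two arrows of `e`.  Take `G` and one copy of `H` for each edge `d` of
`G` and form the 2-sum at each `d`: if the coupling sends the arrows `p₁p₂`, `p₃p₄` of `d` to the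
arrows `q₁q₂`, `q₃q₄` of the copy of `e`, remove these four arrows together with the segments they
cover and identify `pᵢ` with `qᵢ` (here the identified points are joined by a new segment without
arrow).  The edges of the tensor product are the edges other than `e` of all copies of `H`. -/
noncomputable def tensor {E P E' P' : Type*} (G : ArrowPresentation E P)
    (H : ArrowPresentation E' P') (e : E') (φ : E → Equiv.Perm Bool) :
    ArrowPresentation (E × {h : E' // h ≠ e}) (P ⊕ (E × P')) where
  arc := Sum.map G.arc (Prod.map id H.arc)
  seg := reglue (G.tensorPt H e φ) (fun s => (s.1, !s.2)) (Sum.map G.seg (Prod.map id H.seg))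
  arc_involutive := by
    rintro (x | ⟨d, x⟩)
    · simp [G.arc_involutive x]
    · simp [H.arc_involutive x]
  seg_involutive := by
    refine reglue_involutive (G.tensorPt_injective H e φ) (fun s => by simp) ?_ ?_
    · rintro (x | ⟨d, x⟩)
      · simp [G.seg_involutive x]
      · simp [H.seg_involutive x]
    · rintro ⟨⟨d, i, t⟩, _ | _⟩
      · exact ⟨((d, i, !t), false), by simp [tensorPt, G.seg_pt]⟩
      · exact ⟨((d, i, !t), true), by simp [tensorPt, H.seg_pt]⟩
  arc_ne := by
    rintro (x | ⟨d, x⟩) <;> simp [G.arc_ne, H.arc_ne]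
  seg_ne := by
    refine reglue_ne (G.tensorPt_injective H e φ) ?_ ?_
    · rintro ⟨s, b⟩ h
      simp at h
    · rintro (x | ⟨d, x⟩) <;> simp [G.seg_ne, H.seg_ne]
  pt s := Sum.inr (s.1.1, H.pt (s.1.2.1, s.2))
  pt_injective := by
    rintro ⟨⟨d, ⟨h, hh⟩⟩, s⟩ ⟨⟨d', ⟨h', hh'⟩⟩, s'⟩ heq
    have h1 := Sum.inr_injective heq
    obtain rfl : d = d' := congrArg Prod.fst h1
    have h2 := H.pt_injective (congrArg Prod.snd h1)
    simpa using h2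
  seg_pt := by
    rintro ⟨d, ⟨h, hh⟩⟩ i t
    rw [reglue_of_not_mem]
    · simp [H.seg_pt]
    · rintro ⟨⟨⟨d', i', t'⟩, _ | _⟩, hs⟩
      · simp [tensorPt] at hs
      · have h2 := H.pt_injective (congrArg Prod.snd (Sum.inr_injective hs))
        exact hh (congrArg Prod.fst h2).symm

/-- The multivariate Bollobás–Riordan polynomial, evaluated at elements of a commutative ring:
the sum over all `A ⊆ E` of `a ^ k(A) * (∏ e ∈ A, b e) * c ^ b(A)`, where `k(A)` and `b(A)` are the
numbers of connected components and of boundary components of the spanning sub-presentation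
with edge set `A`. -/
noncomputable def multiBR {E P K : Type*} [Fintype E] [CommRing K] (G : ArrowPresentation E P)
    (a : K) (b : E → K) (c : K) : K :=
  ∑ A : Finset E, a ^ (G.restrict (A : Set E)).numComponents * (∏ e ∈ A, b e) *
    c ^ (G.restrict (A : Set E)).numBoundary

end ArrowPresentation

/-! A set of edges of the tensor product is a family of sets `A`, one in each copy of `H \ e`. Cut
the arrows of `e` open. Components and boundary components of a copy that avoid the four ends of `e`
are counted on the spot (`compAvoiding`, `bdryAvoiding`); otherwise `G` sees only the two partitions
induced on these ends. Since `e` is not a loop, the two ends of each arrow lie in one component, so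
the component partition is either by arrow or trivial (`Joins`). Each opened boundary curve has two
ends (`exists_ne_linkMk_bdryLink_openAt`). If `A` does not join the arrows, the curves connect the
two ends of each arrow, as if the edge of `G` were deleted. If `A` joins them, planarity forces the
curves to run as along the sides of a band (`Plane.linkMk_bdryLink_iff`), as if the edge were kept.
The reason is that b - 2k - |A| is constant on a plane graph (`Plane.excess_eq`). So each copy
contributes J = `joinedSum` at a kept edge and S = `separatedSum` at a deleted one
(`Plane.multiBR_tensor`). The same count for `H \ e` and `H / e` gives (ac)²S + acJ and acS + ac²J,
so the system has solution f = acJ, g = acS, and dividing out the g's gives the formula. Among the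
terms of S, only the empty set has its exponents of a and c, whence S ≠ 0 in the generic case. -/

/-! ### Counting classes after gluing, and a parity argument. -/

/-- The extra links touch marked points `v s` only: unmarked classes survive unchanged, and the
marked ones merge as computed on the index set alone. -/
theorem Nat.card_quot_glue {X ι : Type*} [Finite X] [Finite ι] {r r' : X → X → Prop}
    {τ : ι → ι → Prop} {v : ι → X} (h₁ : ∀ x y, r x y → r' x y)
    (h₂ : ∀ s s', τ s s' → r' (v s) (v s'))
    (h₃ : ∀ x y, r' x y → r x y ∨ ∃ s s', τ s s' ∧ x = v s ∧ y = v s') :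
    Nat.card (Quot r') = Nat.card {c : Quot r // ∀ s, Quot.mk r (v s) ≠ c} +
      Nat.card (Quot fun s s' => Quot.mk r (v s) = Quot.mk r (v s') ∨ τ s s') := by
  classical
  set ρ : ι → ι → Prop := fun s s' => Quot.mk r (v s) = Quot.mk r (v s') ∨ τ s s' with hρ
  have hmap : ∀ x y, Quot.mk r x = Quot.mk r y → Quot.mk r' x = Quot.mk r' y := fun x y h =>
    congrArg (Quot.lift (Quot.mk r') fun x y h => Quot.sound (h₁ x y h)) h
  let F₀ : Quot r → {c : Quot r // ∀ s, Quot.mk r (v s) ≠ c} ⊕ Quot ρ := fun c =>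
    if h : ∃ s, Quot.mk r (v s) = c then .inr (Quot.mk ρ h.choose)
    else .inl ⟨c, fun s hs => h ⟨s, hs⟩⟩
  -- The chosen index does not matter, since `ρ` identifies indices whose points share an `r`-class.
  have hF : ∀ s, F₀ (Quot.mk r (v s)) = .inr (Quot.mk ρ s) := by
    intro s
    have h : ∃ s', Quot.mk r (v s') = Quot.mk r (v s) := ⟨s, rfl⟩
    simp only [F₀, dif_pos h]
    exact congrArg _ (Quot.sound (Or.inl h.choose_spec))
  let F : Quot r' → {c : Quot r // ∀ s, Quot.mk r (v s) ≠ c} ⊕ Quot ρ :=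
    Quot.lift (fun x => F₀ (Quot.mk r x)) (by
      intro x y h
      rcases h₃ x y h with h' | ⟨s, s', h', rfl, rfl⟩
      · exact congrArg F₀ (Quot.sound h')
      · simp only [hF]
        exact congrArg _ (Quot.sound (Or.inr h')))
  let B : {c : Quot r // ∀ s, Quot.mk r (v s) ≠ c} ⊕ Quot ρ → Quot r' :=
    Sum.elim (fun c => Quot.lift (Quot.mk r') (fun x y h => Quot.sound (h₁ x y h)) c.1)
      (Quot.lift (fun s => Quot.mk r' (v s)) (by
        rintro s s' (h | h)
        · exact hmap _ _ h
        · exact Quot.sound (h₂ _ _ h)))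
  rw [← Nat.card_sum]
  refine Nat.card_congr ⟨F, B, ?_, ?_⟩
  · rintro ⟨x⟩
    by_cases h : ∃ s, Quot.mk r (v s) = Quot.mk r x
    · obtain ⟨s, hs⟩ := h
      change B (F₀ (Quot.mk r x)) = Quot.mk r' x
      rw [← hs, hF]
      exact hmap _ _ hs
    · change B (F₀ (Quot.mk r x)) = Quot.mk r' x
      simp only [F₀, dif_neg h]
      rfl
  · rintro (⟨⟨x⟩, hx⟩ | ⟨⟨s⟩⟩)
    · change F₀ (Quot.mk r x) = _
      have h : ¬ ∃ s, Quot.mk r (v s) = Quot.mk r x := fun ⟨s, hs⟩ => hx s hs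
      simp only [F₀, dif_neg h]
    · exact hF s

/-- Each copy of `X` is attached to `M` at marked points only, so `M` notices nothing but which of
them the copy connects. -/
theorem Nat.card_quot_sum_prod {M I X ι : Type*} [Finite M] [Fintype I] [Finite X]
    {q : M → M → Prop} {r : I → X → X → Prop} {u : I → ι → M} {v : I → ι → X}
    {r' : M ⊕ I × X → M ⊕ I × X → Prop}
    (h₁ : ∀ x y, q x y → r' (.inl x) (.inl y))
    (h₂ : ∀ d x y, r d x y → r' (.inr (d, x)) (.inr (d, y)))
    (h₃ : ∀ d s, r' (.inl (u d s)) (.inr (d, v d s)))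
    (h₄ : ∀ x y, r' x y → (∃ x' y', q x' y' ∧ x = .inl x' ∧ y = .inl y') ∨
      (∃ d x' y', r d x' y' ∧ x = .inr (d, x') ∧ y = .inr (d, y')) ∨
      (∃ d s, x = .inl (u d s) ∧ y = .inr (d, v d s)) ∨
      ∃ d s, y = .inl (u d s) ∧ x = .inr (d, v d s)) :
    Nat.card (Quot r') =
      ∑ d, Nat.card {c : Quot (r d) // ∀ s, Quot.mk (r d) (v d s) ≠ c} +
      Nat.card (Quot fun x y => q x y ∨ ∃ d s s',
        Quot.mk (r d) (v d s) = Quot.mk (r d) (v d s') ∧ x = u d s ∧ y = u d s') := by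
  classical
  set ρ : M → M → Prop := fun x y => q x y ∨ ∃ d s s',
        Quot.mk (r d) (v d s) = Quot.mk (r d) (v d s') ∧ x = u d s ∧ y = u d s' with hρ
  have hmap : ∀ d x y, Quot.mk (r d) x = Quot.mk (r d) y →
      Quot.mk r' (.inr (d, x)) = Quot.mk r' (.inr (d, y)) := fun d x y h =>
    congrArg (Quot.lift (fun z => Quot.mk r' (.inr (d, z)))
      fun x y h => Quot.sound (h₂ d x y h)) h
  let U := (d : I) × {c : Quot (r d) // ∀ s, Quot.mk (r d) (v d s) ≠ c}
  let F₀ : (d : I) → Quot (r d) → U ⊕ Quot ρ := fun d c =>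
    if h : ∃ s, Quot.mk (r d) (v d s) = c then .inr (Quot.mk ρ (u d h.choose))
    else .inl ⟨d, c, fun s hs => h ⟨s, hs⟩⟩
  have hF : ∀ d s, F₀ d (Quot.mk (r d) (v d s)) = .inr (Quot.mk ρ (u d s)) := by
    intro d s
    have h : ∃ s', Quot.mk (r d) (v d s') = Quot.mk (r d) (v d s) := ⟨s, rfl⟩
    simp only [F₀, dif_pos h]
    exact congrArg _ (Quot.sound (Or.inr ⟨d, _, _, h.choose_spec, rfl, rfl⟩))
  let F₁ : M ⊕ I × X → U ⊕ Quot ρ :=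
    Sum.elim (fun x => .inr (Quot.mk ρ x)) (fun x => F₀ x.1 (Quot.mk _ x.2))
  let F : Quot r' → U ⊕ Quot ρ := Quot.lift F₁ (by
      intro x y h
      rcases h₄ x y h with ⟨x, y, h', rfl, rfl⟩ | ⟨d, x, y, h', rfl, rfl⟩ | ⟨d, s, rfl, rfl⟩ |
        ⟨d, s, rfl, rfl⟩
      · exact congrArg Sum.inr (Quot.sound (Or.inl h'))
      · exact congrArg (F₀ d) (Quot.sound h')
      · exact (hF d s).symm
      · exact hF d s)
  let B : U ⊕ Quot ρ → Quot r' :=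
    Sum.elim (fun c => Quot.lift (fun z => Quot.mk r' (.inr (c.1, z)))
        (fun x y h => Quot.sound (h₂ _ x y h)) c.2.1)
      (Quot.lift (fun x => Quot.mk r' (.inl x)) (by
        rintro x y (h | ⟨d, s, s', h, rfl, rfl⟩)
        · exact Quot.sound (h₁ _ _ h)
        · exact ((Quot.sound (h₃ d s)).trans (hmap _ _ _ h)).trans (Quot.sound (h₃ d s')).symm))
  rw [← Nat.card_sigma, ← Nat.card_sum]
  refine Nat.card_congr ⟨F, B, ?_, ?_⟩
  · rintro ⟨x | ⟨d, x⟩⟩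
    · rfl
    · change B (F₀ d (Quot.mk _ x)) = _
      by_cases h : ∃ s, Quot.mk (r d) (v d s) = Quot.mk (r d) x
      · obtain ⟨s, hs⟩ := h
        rw [← hs, hF]
        exact (Quot.sound (h₃ d s)).trans (hmap _ _ _ hs)
      · simp only [F₀, dif_neg h]
        rfl
  · rintro (⟨d, ⟨x⟩, hx⟩ | ⟨⟨x⟩⟩)
    · change F₀ d (Quot.mk _ x) = _
      have h : ¬ ∃ s, Quot.mk (r d) (v d s) = Quot.mk (r d) x := fun ⟨s, hs⟩ => hx s hs
      simp only [F₀, dif_neg h]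
    · rfl

/-- A quotient of the four ends of an edge whose relation joins ends of the same colour has one
or two classes. -/
theorem Nat.card_quot_of_colour {ι : Type*} {ρ : ι → ι → Prop} (χ : ι → Bool)
    (hχ : Function.Surjective χ) (h : ∀ s s', χ s = χ s' → Quot.mk ρ s = Quot.mk ρ s')
    [Decidable (∃ s s', ρ s s' ∧ χ s ≠ χ s')] :
    Nat.card (Quot ρ) = if ∃ s s', ρ s s' ∧ χ s ≠ χ s' then 1 else 2 := by
  split_ifs with hc
  · obtain ⟨s, s', hs, hne⟩ := hc
    rw [Nat.card_eq_one_iff_unique]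
    refine ⟨⟨?_⟩, ⟨Quot.mk _ s⟩⟩
    have key : ∀ x, Quot.mk ρ x = Quot.mk ρ s := by
      intro x
      by_cases hx : χ x = χ s
      · exact h _ _ hx
      · refine (h x s' ?_).trans (Quot.sound hs).symm
        revert hx hne
        cases χ x <;> cases χ s <;> cases χ s' <;> simp
    rintro ⟨x⟩ ⟨y⟩
    exact (key x).trans (key y).symm
  · push Not at hc
    rw [← Nat.card_eq_two_iff.2 ⟨false, true, by simp, by ext b; cases b <;> simp⟩]
    refine Nat.card_congr (Equiv.ofBijective (Quot.lift χ hc) ⟨?_, ?_⟩)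
    · rintro ⟨x⟩ ⟨y⟩ hxy
      exact h _ _ hxy
    · intro b
      obtain ⟨s, hs⟩ := hχ b
      exact ⟨Quot.mk _ s, hs⟩

/-- If two involutions act on a finite set and the first has no fixed points, then in every orbit
the number of fixed points of the second is different from one. -/
theorem exists_ne_fixed_of_involutive {X : Type*} [Finite X] {r : X → X → Prop} {f g : X → X}
    (hf : Function.Involutive f) (hf' : ∀ x, f x ≠ x) (hg : Function.Involutive g)
    (hfr : ∀ x, Quot.mk r (f x) = Quot.mk r x) (hgr : ∀ x, Quot.mk r (g x) = Quot.mk r x)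
    {x : X} (hx : g x = x) : ∃ y, y ≠ x ∧ g y = y ∧ Quot.mk r y = Quot.mk r x := by
  classical
  have := Fintype.ofFinite X
  by_contra! hcon
  set S : Finset X := Finset.univ.filter fun y => Quot.mk r y = Quot.mk r x with hS
  have hmem : ∀ y, y ∈ S ↔ Quot.mk r y = Quot.mk r x := by simp [hS]
  -- Modulo 2: `f` pairs off the whole class of `x`, while `g`, having `x` as its only fixed point
  -- there, pairs off the class without `x`. Both cardinalities would be even.
  have h1 : ∑ y ∈ S, (1 : ZMod 2) = 0 :=
    Finset.sum_involution (fun y _ => f y) (fun _ _ => by decide) (fun y _ _ => hf' y)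
      (fun y hy => (hmem _).2 ((hfr y).trans ((hmem y).1 hy))) (fun y _ => hf y)
  have h2 : ∑ y ∈ S.erase x, (1 : ZMod 2) = 0 :=
    Finset.sum_involution (fun y _ => g y) (fun _ _ => by decide)
      (fun y hy _ hgy => hcon y (Finset.ne_of_mem_erase hy) hgy
        ((hmem y).1 (Finset.mem_of_mem_erase hy)))
      (fun y hy => by
        refine Finset.mem_erase.2 ⟨fun h => Finset.ne_of_mem_erase hy ?_,
          (hmem _).2 ((hgr y).trans ((hmem y).1 (Finset.mem_of_mem_erase hy)))⟩
        rw [← hg y, h, hx])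
      (fun y _ => hg y)
  rw [← Finset.add_sum_erase S _ ((hmem x).2 rfl), h2] at h1
  simp at h1

/-! ### Components and boundary components as classes of linkings. -/

namespace ArrowPresentation

/-- For every edge, a relation that tells which of its four points are joined to each other. -/
abbrev Linking (E : Type*) := E → Bool × Bool → Bool × Bool → Prop

/-- The relation that joins the marked points along arcs, along segments without arrow, and
as prescribed by `L` at the edges. -/
def linkRel {E P : Type*} (G : ArrowPresentation E P) (L : Linking E) (x y : P) : Prop :=
  y = G.arc x ∨ (x ∉ Set.range G.pt ∧ y = G.seg x) ∨
    ∃ d s s', L d s s' ∧ x = G.pt (d, s) ∧ y = G.pt (d, s')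

/-- The class of a point for the equivalence relation generated by `linkRel`. -/
def linkMk {E P : Type*} (G : ArrowPresentation E P) (L : Linking E) (x : P) :
    Quot (G.linkRel L) :=
  Quot.mk _ x

/-- The number of classes of the equivalence relation generated by `linkRel`. -/
noncomputable def linkCard {E P : Type*} (G : ArrowPresentation E P) (L : Linking E) : ℕ :=
  Nat.card (Quot (G.linkRel L))

/-- The number of classes that contain no point of the edge `e`. -/
noncomputable def linkCardAvoiding {E P : Type*} (G : ArrowPresentation E P) (L : Linking E)
    (e : E) : ℕ :=
  Nat.card {c : Quot (G.linkRel L) // ∀ s, G.linkMk L (G.pt (e, s)) ≠ c}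

/-- Linking of the ends on the same arrow, and of all ends of the edges in `A`. -/
def compLink {E : Type*} (A : Set E) : Linking E := fun d s s' => s.1 = s'.1 ∨ d ∈ A

/-- Linking of the ends along the boundary of the ribbon subgraph with edge set `A`. -/
def bdryLink {E : Type*} (A : Set E) : Linking E := fun d s s' =>
  (d ∈ A ∧ s' = (!s.1, !s.2)) ∨ (d ∉ A ∧ s' = (s.1, !s.2))

/-- Forget the linking at the edge `e`. -/
def openAt {E : Type*} (L : Linking E) (e : E) : Linking E := fun d s s' => d ≠ e ∧ L d s s'

section

variable {E P : Type*} (G : ArrowPresentation E P)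

theorem linkMk_arc (L : Linking E) (x : P) : G.linkMk L (G.arc x) = G.linkMk L x :=
  Eq.symm (Quot.sound (r := G.linkRel L) (Or.inl rfl))

theorem linkMk_seg (L : Linking E) {x : P} (hx : x ∉ Set.range G.pt) :
    G.linkMk L (G.seg x) = G.linkMk L x :=
  Eq.symm (Quot.sound (r := G.linkRel L) (Or.inr (Or.inl ⟨hx, rfl⟩)))

theorem linkMk_pt {L : Linking E} {d : E} {s s' : Bool × Bool} (h : L d s s') :
    G.linkMk L (G.pt (d, s)) = G.linkMk L (G.pt (d, s')) :=
  Quot.sound (Or.inr (Or.inr ⟨d, s, s', h, rfl, rfl⟩))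

variable {G}

theorem linkMk_mono {L L' : Linking E}
    (h : ∀ d s s', L d s s' → G.linkMk L' (G.pt (d, s)) = G.linkMk L' (G.pt (d, s'))) {x y : P}
    (hxy : G.linkMk L x = G.linkMk L y) : G.linkMk L' x = G.linkMk L' y := by
  refine congrArg (Quot.lift (G.linkMk L') ?_) hxy
  rintro x y (rfl | ⟨hx, rfl⟩ | ⟨d, s, s', hL, rfl, rfl⟩)
  · exact (G.linkMk_arc L' x).symm
  · exact (G.linkMk_seg L' hx).symm
  · exact h d s s' hL

theorem card_quot_eq_of_equivalent {X : Type*} {r r' : X → X → Prop}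
    (h : ∀ x y, r x y → Quot.mk r' x = Quot.mk r' y)
    (h' : ∀ x y, r' x y → Quot.mk r x = Quot.mk r y) : Nat.card (Quot r) = Nat.card (Quot r') :=
  Nat.card_congr ⟨Quot.lift (Quot.mk r') h, Quot.lift (Quot.mk r) h',
    by rintro ⟨x⟩; rfl, by rintro ⟨x⟩; rfl⟩

theorem linkCard_congr {L L' : Linking E}
    (h : ∀ d s s', L d s s' → G.linkMk L' (G.pt (d, s)) = G.linkMk L' (G.pt (d, s')))
    (h' : ∀ d s s', L' d s s' → G.linkMk L (G.pt (d, s)) = G.linkMk L (G.pt (d, s'))) :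
    G.linkCard L = G.linkCard L' :=
  card_quot_eq_of_equivalent (fun _ _ hxy => linkMk_mono h (Quot.sound hxy))
    (fun _ _ hxy => linkMk_mono h' (Quot.sound hxy))

variable (G)

/-- `compLink` has more direct links than `Component`, but the segments under the arrows together
with the links between corresponding ends generate them all. -/
theorem numComponents_restrict (A : Set E) :
    (G.restrict A).numComponents = G.linkCard (compLink A) := by
  refine card_quot_eq_of_equivalent ?_ ?_
  · rintro x y (rfl | rfl | ⟨⟨d, hd⟩, t, rfl, rfl⟩)
    · exact (G.linkMk_arc _ x).symm
    · by_cases hx : x ∈ Set.range G.pt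
      · obtain ⟨⟨d, i, t⟩, rfl⟩ := hx
        change G.linkMk _ _ = G.linkMk _ (G.seg _)
        rw [G.seg_pt]
        exact G.linkMk_pt (Or.inl rfl)
      · exact (G.linkMk_seg _ hx).symm
    · exact G.linkMk_pt (Or.inr hd)
  · have hseg : ∀ d i t t', Quot.mk (fun x y : P => y = (G.restrict A).arc x ∨
        y = (G.restrict A).seg x ∨ ∃ e t, x = (G.restrict A).pt (e, false, t) ∧
          y = (G.restrict A).pt (e, true, t)) (G.pt (d, i, t)) = Quot.mk _ (G.pt (d, i, t')) := by
      intro d i t t'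
      by_cases ht : t = t'
      · rw [ht]
      · have : t' = !t := by revert ht; cases t <;> cases t' <;> simp
        exact Quot.sound (Or.inr (Or.inl (by rw [this]; exact (G.seg_pt d i t).symm)))
    rintro x y (rfl | ⟨-, rfl⟩ | ⟨d, ⟨i, t⟩, ⟨i', t'⟩, h, rfl, rfl⟩)
    · exact Quot.sound (Or.inl rfl)
    · exact Quot.sound (Or.inr (Or.inl rfl))
    · rcases h with h | h
      · obtain rfl : i = i' := h
        exact hseg _ _ _ _
      · have hall : ∀ i t, Quot.mk (fun x y : P => y = (G.restrict A).arc x ∨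
            y = (G.restrict A).seg x ∨ ∃ e t, x = (G.restrict A).pt (e, false, t) ∧
            y = (G.restrict A).pt (e, true, t)) (G.pt (d, i, t)) =
              Quot.mk _ (G.pt (d, true, false)) := by
          intro i t
          refine (hseg _ _ _ false).trans ?_
          cases i
          · exact Quot.sound (Or.inr (Or.inr ⟨⟨d, h⟩, false, rfl, rfl⟩))
          · rfl
        exact (hall _ _).trans (hall _ _).symm

theorem boundarySeg_pt (d : E) (s : Bool × Bool) :
    G.boundarySeg (G.pt (d, s)) = G.pt (d, !s.1, !s.2) :=
  reglue_apply G.pt_injective _ _ (d, s)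

theorem boundarySeg_of_not_mem {x : P} (hx : x ∉ Set.range G.pt) : G.boundarySeg x = G.seg x :=
  reglue_of_not_mem _ _ hx

theorem range_restrict_pt (A : Set E) (d : E) (s : Bool × Bool) :
    G.pt (d, s) ∈ Set.range (G.restrict A).pt ↔ d ∈ A := by
  constructor
  · rintro ⟨⟨d', s'⟩, h⟩
    have : d'.1 = d := congrArg Prod.fst (G.pt_injective h)
    exact this ▸ d'.2
  · intro h
    exact ⟨(⟨d, h⟩, s), rfl⟩

theorem restrict_boundarySeg_pt_of_mem {A : Set E} {d : E} (hd : d ∈ A) (s : Bool × Bool) :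
    (G.restrict A).boundarySeg (G.pt (d, s)) = G.pt (d, !s.1, !s.2) :=
  (G.restrict A).boundarySeg_pt ⟨d, hd⟩ s

theorem restrict_boundarySeg_pt_of_not_mem {A : Set E} {d : E} (hd : d ∉ A) (s : Bool × Bool) :
    (G.restrict A).boundarySeg (G.pt (d, s)) = G.pt (d, s.1, !s.2) :=
  ((G.restrict A).boundarySeg_of_not_mem (mt (G.range_restrict_pt A d s).1 hd)).trans
    (G.seg_pt _ _ _)

theorem restrict_boundarySeg_of_not_mem {A : Set E} {x : P} (hx : x ∉ Set.range G.pt) :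
    (G.restrict A).boundarySeg x = G.seg x := by
  refine (G.restrict A).boundarySeg_of_not_mem ?_
  rintro ⟨s, rfl⟩
  exact hx ⟨_, rfl⟩

theorem numBoundary_restrict (A : Set E) :
    (G.restrict A).numBoundary = G.linkCard (bdryLink A) := by
  refine card_quot_eq_of_equivalent ?_ ?_
  · rintro x y (rfl | rfl)
    · exact (G.linkMk_arc _ x).symm
    · by_cases hx : x ∈ Set.range G.pt
      · obtain ⟨⟨d, s⟩, rfl⟩ := hx
        by_cases hd : d ∈ A
        · rw [G.restrict_boundarySeg_pt_of_mem hd]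
          exact G.linkMk_pt (Or.inl ⟨hd, rfl⟩)
        · rw [G.restrict_boundarySeg_pt_of_not_mem hd]
          exact G.linkMk_pt (Or.inr ⟨hd, rfl⟩)
      · rw [G.restrict_boundarySeg_of_not_mem hx]
        exact (G.linkMk_seg _ hx).symm
  · rintro x y (rfl | ⟨hx, rfl⟩ | ⟨d, s, s', ⟨hd, rfl⟩ | ⟨hd, rfl⟩, rfl, rfl⟩)
    · exact Quot.sound (Or.inl rfl)
    · exact Quot.sound (Or.inr (G.restrict_boundarySeg_of_not_mem hx).symm)
    · exact Quot.sound (Or.inr (G.restrict_boundarySeg_pt_of_mem hd s).symm)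
    · exact Quot.sound (Or.inr (G.restrict_boundarySeg_pt_of_not_mem hd s).symm)

/-- Isolates the role of `e`: the first summand depends only on the linking at the other edges. -/
theorem linkCard_openAt [Finite P] (L : Linking E) (e : E) :
    G.linkCard L = G.linkCardAvoiding (openAt L e) e +
      Nat.card (Quot fun s s' => G.linkMk (openAt L e) (G.pt (e, s)) =
        G.linkMk (openAt L e) (G.pt (e, s')) ∨ L e s s') := by
  refine Nat.card_quot_glue (τ := L e) (v := fun s => G.pt (e, s)) ?_ ?_ ?_
  · rintro x y (h | h | ⟨d, s, s', h, h'⟩)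
    · exact Or.inl h
    · exact Or.inr (Or.inl h)
    · exact Or.inr (Or.inr ⟨d, s, s', h.2, h'⟩)
  · intro s s' h
    exact Or.inr (Or.inr ⟨e, s, s', h, rfl, rfl⟩)
  · rintro x y (h | h | ⟨d, s, s', h, h'⟩)
    · exact Or.inl (Or.inl h)
    · exact Or.inl (Or.inr (Or.inl h))
    · by_cases hd : d = e
      · subst hd
        exact Or.inr ⟨s, s', h, h'⟩
      · exact Or.inl (Or.inr (Or.inr ⟨d, s, s', ⟨hd, h⟩, h'⟩))

/-- If the boundary of a ribbon subgraph is cut open at `e`, every boundary arc has two ends. -/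
theorem exists_ne_linkMk_bdryLink_openAt [Finite P] (A : Set E) (e : E) (s : Bool × Bool) :
    ∃ s', s' ≠ s ∧ G.linkMk (openAt (bdryLink A) e) (G.pt (e, s')) =
      G.linkMk (openAt (bdryLink A) e) (G.pt (e, s)) := by
  classical
  -- Regluing by `τ` follows the boundary but stops at `e`: its fixed points are exactly the four
  -- ends of `e`.
  let τ : E × Bool × Bool → E × Bool × Bool := fun p =>
    if p.1 = e then p else if p.1 ∈ A then (p.1, !p.2.1, !p.2.2) else (p.1, p.2.1, !p.2.2)
  have hτ : Function.Involutive τ := by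
    rintro ⟨d, i, t⟩
    by_cases hd : d = e <;> by_cases hA : d ∈ A <;> simp [τ, hd, hA]
  have hinv : Function.Involutive (reglue G.pt τ G.seg) :=
    reglue_involutive G.pt_injective hτ G.seg_involutive
      (by rintro ⟨d, i, t⟩; exact ⟨(d, i, !t), (G.seg_pt d i t).symm⟩)
  have hfix : ∀ s, reglue G.pt τ G.seg (G.pt (e, s)) = G.pt (e, s) := fun s => by
    rw [reglue_apply G.pt_injective]; simp [τ]
  obtain ⟨y, hy, hy', hr⟩ := exists_ne_fixed_of_involutive
    (r := G.linkRel (openAt (bdryLink A) e)) G.arc_involutive G.arc_ne hinv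
    (fun x => G.linkMk_arc _ x) (fun x => by
      by_cases hx : x ∈ Set.range G.pt
      · obtain ⟨⟨d, i, t⟩, rfl⟩ := hx
        rw [reglue_apply G.pt_injective]
        by_cases hd : d = e
        · simp [τ, hd]
        · by_cases hA : d ∈ A
          · have h : τ (d, i, t) = (d, !i, !t) := by simp [τ, hd, hA]
            rw [h]
            exact (G.linkMk_pt ⟨hd, Or.inl ⟨hA, rfl⟩⟩).symm
          · have h : τ (d, i, t) = (d, i, !t) := by simp [τ, hd, hA]
            rw [h]
            exact (G.linkMk_pt ⟨hd, Or.inr ⟨hA, rfl⟩⟩).symm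
      · rw [reglue_of_not_mem _ _ hx]
        exact G.linkMk_seg _ hx) (hfix s)
  by_cases hyr : y ∈ Set.range G.pt
  · obtain ⟨⟨d, s'⟩, rfl⟩ := hyr
    rw [reglue_apply G.pt_injective] at hy'
    have h1 := G.pt_injective hy'
    have hd : d = e := by
      by_contra hd
      by_cases hA : d ∈ A <;> simp [τ, hd, hA] at h1 <;>
        simpa using congrArg (fun p : Bool × Bool => p.2) h1
    subst hd
    exact ⟨s', fun h => hy (by rw [h]), hr⟩
  · rw [reglue_of_not_mem _ _ hyr] at hy'
    exact absurd hy' (G.seg_ne y)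

end

/-! ### Deletion, contraction and tensor product in terms of linkings. -/

/-- Extend a linking of the edges other than `e` to all edges, without links at `e`. -/
def extendLink {E : Type*} {e : E} (L : Linking {h : E // h ≠ e}) : Linking E := fun h s s' =>
  ∃ hne : h ≠ e, L ⟨h, hne⟩ s s'

/-- Extend a linking of the edges other than `e` to all edges, with links `τ` at `e`. -/
def extendLinkBy {E : Type*} {e : E} (L : Linking {h : E // h ≠ e})
    (τ : Bool × Bool → Bool × Bool → Prop) : Linking E := fun h s s' =>
  extendLink L h s s' ∨ h = e ∧ τ s s'

section

variable {E : Type*} {e : E}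

theorem openAt_extendLinkBy (L : Linking {h : E // h ≠ e})
    (τ : Bool × Bool → Bool × Bool → Prop) : openAt (extendLinkBy L τ) e = extendLink L := by
  funext h s s'
  refine propext ⟨?_, fun h' => ⟨h'.1, Or.inl h'⟩⟩
  rintro ⟨hne, h | h⟩
  · exact h
  · exact absurd h.1 hne

theorem mem_image_val_iff {A : Set {h : E // h ≠ e}} {h : E} (hne : h ≠ e) :
    h ∈ Subtype.val '' A ↔ ⟨h, hne⟩ ∈ A := by
  simp [hne]

theorem extendLink_compLink (A : Set {h : E // h ≠ e}) :
    extendLink (compLink A) = openAt (compLink (Subtype.val '' A)) e := by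
  funext h s s'
  refine propext ⟨fun ⟨hne, h'⟩ => ⟨hne, ?_⟩, fun ⟨hne, h'⟩ => ⟨hne, ?_⟩⟩
  · rwa [compLink, mem_image_val_iff hne]
  · rwa [compLink, mem_image_val_iff hne] at h'

theorem extendLink_bdryLink (A : Set {h : E // h ≠ e}) :
    extendLink (bdryLink A) = openAt (bdryLink (Subtype.val '' A)) e := by
  funext h s s'
  refine propext ⟨fun ⟨hne, h'⟩ => ⟨hne, ?_⟩, fun ⟨hne, h'⟩ => ⟨hne, ?_⟩⟩
  · rwa [bdryLink, mem_image_val_iff hne]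
  · rwa [bdryLink, mem_image_val_iff hne] at h'

theorem openAt_compLink_insert (A : Set E) :
    openAt (compLink (insert e A)) e = openAt (compLink A) e := by
  funext h s s'
  refine propext (and_congr_right fun hne => ?_)
  simp [compLink, hne]

theorem openAt_bdryLink_insert (A : Set E) :
    openAt (bdryLink (insert e A)) e = openAt (bdryLink A) e := by
  funext h s s'
  refine propext (and_congr_right fun hne => ?_)
  simp [bdryLink, hne]

end

section

variable {E P : Type*} (H : ArrowPresentation E P) (e : E)

/-- Deletion and contraction differ only in the links at `e`: along each arrow here, crosswise from
tail to head of the other arrow in `linkCard_contract`. -/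
theorem linkCard_delete (L : Linking {h : E // h ≠ e}) :
    (H.delete e).linkCard L = H.linkCard (extendLinkBy L fun s s' => s' = (s.1, !s.2)) := by
  refine card_quot_eq_of_equivalent ?_ ?_
  · rintro x y (rfl | ⟨hx, rfl⟩ | ⟨d, s, s', h, rfl, rfl⟩)
    · exact (H.linkMk_arc _ x).symm
    · by_cases hx' : x ∈ Set.range H.pt
      · obtain ⟨⟨d, s⟩, rfl⟩ := hx'
        by_cases hd : d = e
        · subst hd
          change H.linkMk _ _ = H.linkMk _ (H.seg _)
          rw [H.seg_pt]
          exact H.linkMk_pt (Or.inr ⟨rfl, rfl⟩)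
        · exact absurd ⟨(⟨d, hd⟩, s), rfl⟩ hx
      · exact (H.linkMk_seg _ hx').symm
    · exact H.linkMk_pt (Or.inl ⟨d.2, h⟩)
  · rintro x y (rfl | ⟨hx, rfl⟩ | ⟨d, s, s', ⟨hne, h⟩ | ⟨rfl, rfl⟩, rfl, rfl⟩)
    · exact ((H.delete e).linkMk_arc _ x).symm
    · refine ((H.delete e).linkMk_seg _ ?_).symm
      rintro ⟨s, rfl⟩
      exact hx ⟨_, rfl⟩
    · exact (H.delete e).linkMk_pt (d := ⟨d, hne⟩) h
    · rw [← H.seg_pt]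
      refine ((H.delete d).linkMk_seg _ ?_).symm
      rintro ⟨⟨d', s'⟩, h⟩
      exact d'.2 (congrArg Prod.fst (H.pt_injective h))

theorem contract_seg_pt (s : Bool × Bool) :
    (H.contract e).seg (H.pt (e, s)) = H.pt (e, !s.1, !s.2) :=
  reglue_apply (q := fun s : Bool × Bool => H.pt (e, s))
    (fun s s' h => by simpa using H.pt_injective h) (fun s => (!s.1, !s.2)) H.seg s

theorem contract_seg_of_not_mem {x : P} (hx : x ∉ Set.range H.pt) :
    (H.contract e).seg x = H.seg x :=
  reglue_of_not_mem (q := fun s : Bool × Bool => H.pt (e, s)) (fun s => (!s.1, !s.2)) H.seg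
    (by rintro ⟨s, rfl⟩; exact hx ⟨_, rfl⟩)

theorem linkCard_contract (L : Linking {h : E // h ≠ e}) :
    (H.contract e).linkCard L = H.linkCard (extendLinkBy L fun s s' => s' = (!s.1, !s.2)) := by
  refine card_quot_eq_of_equivalent ?_ ?_
  · rintro x y (rfl | ⟨hx, rfl⟩ | ⟨d, s, s', h, rfl, rfl⟩)
    · exact (H.linkMk_arc _ x).symm
    · by_cases hx' : x ∈ Set.range H.pt
      · obtain ⟨⟨d, s⟩, rfl⟩ := hx'
        by_cases hd : d = e
        · subst hd
          rw [contract_seg_pt]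
          exact H.linkMk_pt (Or.inr ⟨rfl, rfl⟩)
        · exact absurd ⟨(⟨d, hd⟩, s), rfl⟩ hx
      · rw [contract_seg_of_not_mem _ _ hx']
        exact (H.linkMk_seg _ hx').symm
    · exact H.linkMk_pt (Or.inl ⟨d.2, h⟩)
  · rintro x y (rfl | ⟨hx, rfl⟩ | ⟨d, s, s', ⟨hne, h⟩ | ⟨rfl, rfl⟩, rfl, rfl⟩)
    · exact ((H.contract e).linkMk_arc _ x).symm
    · rw [← contract_seg_of_not_mem H e hx]
      refine ((H.contract e).linkMk_seg _ ?_).symm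
      rintro ⟨s, rfl⟩
      exact hx ⟨_, rfl⟩
    · exact (H.contract e).linkMk_pt (d := ⟨d, hne⟩) h
    · rw [← contract_seg_pt]
      refine ((H.contract d).linkMk_seg _ ?_).symm
      rintro ⟨⟨d', s'⟩, h⟩
      exact d'.2 (congrArg Prod.fst (H.pt_injective h))

end

section

variable {E P E' P' : Type*} (G : ArrowPresentation E P) (H : ArrowPresentation E' P') (e : E')
  (φ : E → Equiv.Perm Bool)

theorem tensor_seg_inl_pt (d : E) (i t : Bool) :
    (G.tensor H e φ).seg (.inl (G.pt (d, i, t))) = .inr (d, H.pt (e, φ d i, t)) :=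
  reglue_apply (G.tensorPt_injective H e φ) (fun s => (s.1, !s.2))
    (Sum.map G.seg (Prod.map id H.seg)) ((d, i, t), false)

theorem tensor_seg_inr_pt (d : E) (i t : Bool) :
    (G.tensor H e φ).seg (.inr (d, H.pt (e, φ d i, t))) = .inl (G.pt (d, i, t)) :=
  reglue_apply (G.tensorPt_injective H e φ) (fun s => (s.1, !s.2))
    (Sum.map G.seg (Prod.map id H.seg)) ((d, i, t), true)

theorem tensor_seg_inl {x : P} (hx : x ∉ Set.range G.pt) :
    (G.tensor H e φ).seg (.inl x) = .inl (G.seg x) := by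
  refine reglue_of_not_mem (q := G.tensorPt H e φ) (fun s => (s.1, !s.2))
    (Sum.map G.seg (Prod.map id H.seg)) ?_
  rintro ⟨⟨⟨d, i, t⟩, _ | _⟩, h⟩
  · exact hx ⟨_, Sum.inl_injective h⟩
  · simp [tensorPt] at h

theorem tensor_seg_inr (d : E) {x : P'} (hx : x ∉ Set.range H.pt) :
    (G.tensor H e φ).seg (.inr (d, x)) = .inr (d, H.seg x) := by
  refine reglue_of_not_mem (q := G.tensorPt H e φ) (fun s => (s.1, !s.2))
    (Sum.map G.seg (Prod.map id H.seg)) ?_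
  rintro ⟨⟨⟨d, i, t⟩, _ | _⟩, h⟩
  · simp [tensorPt] at h
  · exact hx ⟨_, congrArg Prod.snd (Sum.inr_injective h)⟩

theorem inl_not_mem_range_tensor_pt (x : P) :
    Sum.inl x ∉ Set.range (G.tensor H e φ).pt := by
  rintro ⟨s, h⟩
  exact Sum.inr_ne_inl h

theorem inr_not_mem_range_tensor_pt (d : E) {x : P'}
    (hx : ∀ h s, h ≠ e → x ≠ H.pt (h, s)) :
    Sum.inr (d, x) ∉ Set.range (G.tensor H e φ).pt := by
  rintro ⟨⟨⟨d', h, hne⟩, s⟩, heq⟩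
  exact hx h s hne (congrArg Prod.snd (Sum.inr_injective heq)).symm

/-- Seen from `G`, the copy of `H` at `d` is just a linking of the four ends of `d`, transported by
the coupling from the partition of the ends of `e`. -/
theorem linkCard_tensor [Fintype E] [Finite P] [Finite P']
    {L : Linking (E × {h : E' // h ≠ e})} {L₀ : E → Linking E'}
    (hL₀ : ∀ d, (extendLink fun h => L (d, h)) = L₀ d) :
    (G.tensor H e φ).linkCard L = ∑ d, H.linkCardAvoiding (L₀ d) e +
      G.linkCard fun d s s' =>
        H.linkMk (L₀ d) (H.pt (e, φ d s.1, s.2)) =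
        H.linkMk (L₀ d) (H.pt (e, φ d s'.1, s'.2)) := by
  obtain rfl := funext hL₀
  refine (Nat.card_quot_sum_prod (q := G.linkRel fun _ _ _ => False)
    (r := fun d => H.linkRel (extendLink fun h => L (d, h))) (u := fun d s => G.pt (d, s))
    (v := fun d s => H.pt (e, φ d s.1, s.2)) ?_ ?_ ?_ ?_).trans ?_
  · rintro x y (rfl | ⟨hx, rfl⟩ | ⟨d, s, s', h, -⟩)
    · exact Or.inl rfl
    · exact Or.inr (Or.inl ⟨G.inl_not_mem_range_tensor_pt H e φ x,
        (G.tensor_seg_inl H e φ hx).symm⟩)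
    · exact h.elim
  · rintro d x y (rfl | ⟨hx, rfl⟩ | ⟨h, s, s', ⟨hne, hL⟩, rfl, rfl⟩)
    · exact Or.inl rfl
    · exact Or.inr (Or.inl ⟨G.inr_not_mem_range_tensor_pt H e φ d
        fun h s _ hs => hx ⟨_, hs.symm⟩, (G.tensor_seg_inr H e φ d hx).symm⟩)
    · exact Or.inr (Or.inr ⟨(d, ⟨h, hne⟩), s, s', hL, rfl, rfl⟩)
  · rintro d ⟨i, t⟩
    exact Or.inr (Or.inl ⟨G.inl_not_mem_range_tensor_pt H e φ _,
      (G.tensor_seg_inl_pt H e φ d i t).symm⟩)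
  · rintro x y (rfl | ⟨hx, rfl⟩ | ⟨⟨d, h, hne⟩, s, s', hL, rfl, rfl⟩)
    · rcases x with x | ⟨d, x⟩
      · exact Or.inl ⟨x, _, Or.inl rfl, rfl, rfl⟩
      · exact Or.inr (Or.inl ⟨d, x, _, Or.inl rfl, rfl, rfl⟩)
    · rcases x with x | ⟨d, x⟩
      · by_cases hx' : x ∈ Set.range G.pt
        · obtain ⟨⟨d, i, t⟩, rfl⟩ := hx'
          exact Or.inr (Or.inr (Or.inl ⟨d, (i, t), rfl, G.tensor_seg_inl_pt H e φ d i t⟩))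
        · exact Or.inl ⟨x, _, Or.inr (Or.inl ⟨hx', rfl⟩), rfl, G.tensor_seg_inl H e φ hx'⟩
      · by_cases hx' : x ∈ Set.range H.pt
        · obtain ⟨⟨h, i, t⟩, rfl⟩ := hx'
          by_cases hne : h = e
          · subst hne
            obtain ⟨i, rfl⟩ := (φ d).surjective i
            exact Or.inr (Or.inr (Or.inr ⟨d, (i, t), G.tensor_seg_inr_pt H h φ d i t, rfl⟩))
          · exact absurd ⟨((d, ⟨h, hne⟩), i, t), rfl⟩ hx
        · exact Or.inr (Or.inl ⟨d, x, _, Or.inr (Or.inl ⟨hx', rfl⟩), rfl,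
            G.tensor_seg_inr H e φ d hx'⟩)
    · exact Or.inr (Or.inl ⟨d, _, _, Or.inr (Or.inr ⟨h, s, s', ⟨hne, hL⟩, rfl, rfl⟩), rfl, rfl⟩)
  · congr 1
    -- `φ d` permutes the arrows of `e`, so avoiding all coupled ends is avoiding all ends.
    · refine Finset.sum_congr rfl fun d _ => ?_
      refine Nat.card_congr (Equiv.subtypeEquivRight fun c => ⟨fun h s => ?_, fun h s => h _⟩)
      obtain ⟨i, hi⟩ := (φ d).surjective s.1
      have := h (i, s.2)
      rwa [hi] at this
    · refine card_quot_eq_of_equivalent ?_ ?_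
      · rintro x y ((h | h | ⟨d, s, s', h, -⟩) | ⟨d, s, s', h, h'⟩)
        · exact Quot.sound (Or.inl h)
        · exact Quot.sound (Or.inr (Or.inl h))
        · exact h.elim
        · exact Quot.sound (Or.inr (Or.inr ⟨d, s, s', h, h'⟩))
      · rintro x y (h | h | ⟨d, s, s', h, h'⟩)
        · exact Quot.sound (Or.inl (Or.inl h))
        · exact Quot.sound (Or.inl (Or.inr (Or.inl h)))
        · exact Quot.sound (Or.inr ⟨d, s, s', h, h'⟩)

end

/-! ### One edge at a time: Euler genus and planarity. -/

/-- Two ends of the edge `e` of different colours are linked. -/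
def Crosses {E P : Type*} (H : ArrowPresentation E P) (L : Linking E) (e : E)
    (χ : Bool × Bool → Bool) : Prop :=
  ∃ s s', H.linkMk L (H.pt (e, s)) = H.linkMk L (H.pt (e, s')) ∧ χ s ≠ χ s'

/-- After opening the arrows of `e`, the two arrows of `e` lie in the same component of the
spanning ribbon subgraph with edge set `A`. -/
def Joins {E P : Type*} (H : ArrowPresentation E P) (A : Set E) (e : E) : Prop :=
  H.Crosses (openAt (compLink A) e) e Prod.fst

section

variable {E P : Type*} (H : ArrowPresentation E P) (e : E)

-- Used with two colourings of the ends: `Prod.fst` separates the arrows (`e` absent), and xor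
-- separates the two sides of the band (`e` present). The two colour groups merge exactly when a
-- class outside `e` crosses.
open Classical in
theorem linkCard_eq_of_colour [Finite P] {L L₀ : Linking E} (h₀ : openAt L e = L₀)
    (χ : Bool × Bool → Bool) (hχ : Function.Surjective χ) (h₁ : ∀ s s', L e s s' → χ s = χ s')
    (h₂ : ∀ s s', χ s = χ s' → s = s' ∨ L e s s') :
    H.linkCard L = H.linkCardAvoiding L₀ e + if H.Crosses L₀ e χ then 1 else 2 := by
  subst h₀
  rw [H.linkCard_openAt L e, Nat.card_quot_of_colour χ hχ]
  · congr 2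
    refine propext ⟨?_, fun ⟨s, s', h, h'⟩ => ⟨s, s', Or.inl h, h'⟩⟩
    rintro ⟨s, s', h | h, h'⟩
    · exact ⟨s, s', h, h'⟩
    · exact absurd (h₁ _ _ h) h'
  · intro s s' h
    rcases h₂ s s' h with rfl | h
    · rfl
    · exact Quot.sound (Or.inr h)

theorem surjective_xor : Function.Surjective fun s : Bool × Bool => s.1 ^^ s.2 := by decide

open Classical in
theorem linkCard_compLink_of_not_mem [Finite P] {A : Set E} (he : e ∉ A) :
    H.linkCard (compLink A) =
      H.linkCardAvoiding (openAt (compLink A) e) e + if H.Joins A e then 1 else 2 :=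
  H.linkCard_eq_of_colour e rfl Prod.fst Prod.fst_surjective
    (fun _ _ h => h.resolve_right he) (fun _ _ h => Or.inr (Or.inl h))

theorem linkCard_compLink_insert [Finite P] (A : Set E) :
    H.linkCard (compLink (insert e A)) =
      H.linkCardAvoiding (openAt (compLink A) e) e + 1 := by
  rw [H.linkCard_openAt _ e, openAt_compLink_insert]
  congr 1
  refine Nat.card_eq_one_iff_unique.2 ⟨⟨?_⟩, ⟨Quot.mk _ default⟩⟩
  rintro ⟨s⟩ ⟨s'⟩
  exact Quot.sound (Or.inr (Or.inr (Set.mem_insert _ _)))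

open Classical in
theorem linkCard_bdryLink_of_not_mem [Finite P] {A : Set E} (he : e ∉ A) :
    H.linkCard (bdryLink A) = H.linkCardAvoiding (openAt (bdryLink A) e) e +
      if H.Crosses (openAt (bdryLink A) e) e Prod.fst then 1 else 2 := by
  refine H.linkCard_eq_of_colour e rfl Prod.fst Prod.fst_surjective ?_ ?_
  · rintro s s' (⟨h, -⟩ | ⟨-, rfl⟩)
    · exact absurd h he
    · rfl
  · intro s s' h
    have : s = s' ∨ s' = (s.1, !s.2) := by revert s s'; decide
    exact this.imp_right fun h => Or.inr ⟨he, h⟩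

open Classical in
theorem linkCard_bdryLink_insert [Finite P] (A : Set E) :
    H.linkCard (bdryLink (insert e A)) = H.linkCardAvoiding (openAt (bdryLink A) e) e +
      if H.Crosses (openAt (bdryLink A) e) e (fun s => s.1 ^^ s.2) then 1 else 2 := by
  refine H.linkCard_eq_of_colour e (openAt_bdryLink_insert A) _ surjective_xor ?_ ?_
  · rintro s s' (⟨-, rfl⟩ | ⟨h, -⟩)
    · simp
    · exact absurd (Set.mem_insert _ _) h
  · intro s s' h
    have : s = s' ∨ s' = (!s.1, !s.2) := by revert s s'; decide
    exact this.imp_right fun h => Or.inl ⟨Set.mem_insert _ _, h⟩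

variable {H e}

/-- A boundary curve stays inside a component, also of any larger subgraph. -/
theorem linkMk_compLink_of_bdryLink {A B : Set E} (hAB : A ⊆ B) {x y : P}
    (h : H.linkMk (openAt (bdryLink A) e) x = H.linkMk (openAt (bdryLink A) e) y) :
    H.linkMk (openAt (compLink B) e) x = H.linkMk (openAt (compLink B) e) y := by
  refine linkMk_mono ?_ h
  rintro d s s' ⟨hne, ⟨hd, -⟩ | ⟨-, rfl⟩⟩
  · exact H.linkMk_pt ⟨hne, Or.inr (hAB hd)⟩
  · exact H.linkMk_pt ⟨hne, Or.inl rfl⟩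

/-- If every boundary arc stays within a colour class, it joins the two ends of this colour. -/
theorem linkMk_bdryLink_iff_of_not_crosses [Finite P] {A : Set E} {χ : Bool × Bool → Bool}
    (hχ : ∀ s t t', t ≠ s → t' ≠ s → χ t = χ s → χ t' = χ s → t = t')
    (h : ¬ H.Crosses (openAt (bdryLink A) e) e χ) (s s' : Bool × Bool) :
    H.linkMk (openAt (bdryLink A) e) (H.pt (e, s)) =
      H.linkMk (openAt (bdryLink A) e) (H.pt (e, s')) ↔ χ s = χ s' := by
  constructor
  · intro hs
    by_contra hne
    exact h ⟨s, s', hs, hne⟩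
  · intro hs
    by_cases hss : s' = s
    · rw [hss]
    · obtain ⟨t, ht, ht'⟩ := H.exists_ne_linkMk_bdryLink_openAt A e s
      have htχ : χ t = χ s := by
        by_contra hne
        exact h ⟨t, s, ht', hne⟩
      rw [hχ s s' t hss ht hs.symm htχ, ht']

theorem not_crosses_of_not_joins {A : Set E} (h : ¬ H.Joins A e) :
    ¬ H.Crosses (openAt (bdryLink A) e) e Prod.fst :=
  fun ⟨s, s', hs, hne⟩ => h ⟨s, s', linkMk_compLink_of_bdryLink subset_rfl hs, hne⟩

theorem linkMk_bdryLink_iff_of_not_joins [Finite P] {A : Set E} (h : ¬ H.Joins A e)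
    (s s' : Bool × Bool) :
    H.linkMk (openAt (bdryLink A) e) (H.pt (e, s)) =
      H.linkMk (openAt (bdryLink A) e) (H.pt (e, s')) ↔ s.1 = s'.1 :=
  linkMk_bdryLink_iff_of_not_crosses (χ := Prod.fst) (by decide) (not_crosses_of_not_joins h) s s'

theorem crosses_xor_of_not_joins [Finite P] {A : Set E} (h : ¬ H.Joins A e) :
    H.Crosses (openAt (bdryLink A) e) e (fun s => s.1 ^^ s.2) :=
  ⟨(false, false), (false, true), (linkMk_bdryLink_iff_of_not_joins h _ _).2 rfl, by simp⟩

/-- Adding an edge does not increase `b - 2k - |A|`. -/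
theorem linkCard_insert_le [Finite P] {A : Set E} (he : e ∉ A) :
    H.linkCard (bdryLink (insert e A)) + 2 * H.linkCard (compLink A) ≤
      H.linkCard (bdryLink A) + 2 * H.linkCard (compLink (insert e A)) + 1 := by
  classical
  rw [H.linkCard_bdryLink_insert, H.linkCard_bdryLink_of_not_mem e he,
    H.linkCard_compLink_insert, H.linkCard_compLink_of_not_mem e he]
  -- If `A` joins the arrows, k is unchanged and b changes by at most one. Otherwise both k and b
  -- drop by one, with equality.
  by_cases h : H.Joins A e
  · rw [if_pos h]
    split_ifs <;> omega
  · rw [if_neg h, if_neg (not_crosses_of_not_joins h), if_pos (crosses_xor_of_not_joins h)]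
    omega

/-- Here k is unchanged, so equality makes b grow: the two sides of the band lie on different
boundary components. -/
theorem not_crosses_xor_of_joins [Finite P] {A : Set E} (he : e ∉ A) (h : H.Joins A e)
    (heq : H.linkCard (bdryLink (insert e A)) + 2 * H.linkCard (compLink A) =
      H.linkCard (bdryLink A) + 2 * H.linkCard (compLink (insert e A)) + 1) :
    ¬ H.Crosses (openAt (bdryLink A) e) e (fun s => s.1 ^^ s.2) := by
  classical
  rw [H.linkCard_bdryLink_insert, H.linkCard_bdryLink_of_not_mem e he,
    H.linkCard_compLink_insert, H.linkCard_compLink_of_not_mem e he, if_pos h] at heq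
  intro hc
  rw [if_pos hc] at heq
  split_ifs at heq <;> omega

/-- `b - 2k - |A|` for the spanning ribbon subgraph with edge set `A`. -/
noncomputable def excess {E P : Type*} (H : ArrowPresentation E P) (A : Finset E) : ℤ :=
  H.linkCard (bdryLink (A : Set E)) - 2 * H.linkCard (compLink (A : Set E)) - A.card

/-- By Euler's formula the excess is minus the number of vertices minus the Euler genus, and the
genus cannot fall when edges are added. -/
theorem excess_antitone [Finite P] : Antitone H.excess := by
  classical
  refine Finset.antitone_iff_forall_insert_le.2 fun A e he => ?_
  have := H.linkCard_insert_le (A := (A : Set E)) (e := e) (by simpa using he)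
  simp only [excess, Finset.coe_insert, Finset.card_insert_of_notMem he]
  push_cast
  omega

variable (H)

theorem linkCard_bdryLink_empty : H.linkCard (bdryLink ∅) = H.linkCard (compLink ∅) := by
  refine linkCard_congr ?_ ?_
  · rintro d s s' (⟨h, -⟩ | ⟨-, rfl⟩)
    · exact h.elim
    · exact H.linkMk_pt (Or.inl rfl)
  · rintro d s s' (h | h)
    · have : s = s' ∨ s' = (s.1, !s.2) := by revert s s'; decide
      rcases this with rfl | rfl
      · rfl
      · exact H.linkMk_pt (Or.inr ⟨id, rfl⟩)
    · exact h.elim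

theorem vertexOf_pt (d : E) (i t t' : Bool) :
    H.vertexOf (H.pt (d, i, t)) = H.vertexOf (H.pt (d, i, t')) := by
  by_cases h : t = t'
  · rw [h]
  · have : t' = !t := by revert h; cases t <;> cases t' <;> simp
    exact Quot.sound (Or.inr (by rw [this]; exact (H.seg_pt d i t).symm))

theorem linkCard_compLink_empty : H.linkCard (compLink ∅) = H.numVertices := by
  refine card_quot_eq_of_equivalent ?_ ?_
  · rintro x y (rfl | ⟨-, rfl⟩ | ⟨d, ⟨i, t⟩, ⟨i', t'⟩, h | h, rfl, rfl⟩)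
    · exact Quot.sound (Or.inl rfl)
    · exact Quot.sound (Or.inr rfl)
    · obtain rfl : i = i' := h
      exact H.vertexOf_pt d i t t'
    · exact h.elim
  · rintro x y (rfl | rfl)
    · exact (H.linkMk_arc _ x).symm
    · by_cases hx : x ∈ Set.range H.pt
      · obtain ⟨⟨d, i, t⟩, rfl⟩ := hx
        rw [H.seg_pt]
        exact H.linkMk_pt (Or.inl rfl)
      · exact (H.linkMk_seg _ hx).symm

theorem numComponents_restrict_univ :
    (H.restrict Set.univ).numComponents = H.numComponents := by
  refine card_quot_eq_of_equivalent ?_ ?_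
  · rintro x y (h | h | ⟨d, t, h, h'⟩)
    · exact Quot.sound (Or.inl h)
    · exact Quot.sound (Or.inr (Or.inl h))
    · exact Quot.sound (Or.inr (Or.inr ⟨d.1, t, h, h'⟩))
  · rintro x y (h | h | ⟨d, t, h, h'⟩)
    · exact Quot.sound (Or.inl h)
    · exact Quot.sound (Or.inr (Or.inl h))
    · exact Quot.sound (Or.inr (Or.inr ⟨⟨d, trivial⟩, t, h, h'⟩))

theorem boundarySeg_restrict_univ : (H.restrict Set.univ).boundarySeg = H.boundarySeg := by
  funext x
  by_cases hx : x ∈ Set.range H.pt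
  · obtain ⟨⟨d, s⟩, rfl⟩ := hx
    rw [boundarySeg_pt, H.restrict_boundarySeg_pt_of_mem (Set.mem_univ d)]
  · rw [H.boundarySeg_of_not_mem hx, H.restrict_boundarySeg_of_not_mem hx]

theorem numBoundary_restrict_univ : (H.restrict Set.univ).numBoundary = H.numBoundary := by
  unfold numBoundary Boundary
  rw [boundarySeg_restrict_univ]
  rfl

variable {H}

/-- An antitone function with equal values at `∅` and `univ` is constant: spanning subgraphs of a
plane graph are plane. -/
theorem Plane.excess_eq [Finite P] [Fintype E] (hH : H.Plane) (A : Finset E) :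
    H.excess A = -(H.numVertices : ℤ) := by
  have h0 : H.excess ∅ = -(H.numVertices : ℤ) := by
    simp only [excess, Finset.coe_empty, linkCard_bdryLink_empty, linkCard_compLink_empty,
      Finset.card_empty]
    push_cast
    ring
  have h1 : H.excess Finset.univ = -(H.numVertices : ℤ) := by
    simp only [excess, Finset.coe_univ, ← numBoundary_restrict, ← numComponents_restrict,
      numBoundary_restrict_univ, numComponents_restrict_univ, Finset.card_univ]
    have := hH
    rw [Plane, Nat.card_eq_fintype_card] at this
    omega
  exact le_antisymm (h0 ▸ excess_antitone (Finset.empty_subset A))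
    (h1 ▸ excess_antitone (Finset.subset_univ A))

theorem not_joins_empty (he : ¬ H.IsLoop e) : ¬ H.Joins ∅ e := by
  rintro ⟨⟨i, t⟩, ⟨i', t'⟩, h, hne⟩
  have hv : H.vertexOf (H.pt (e, i, t)) = H.vertexOf (H.pt (e, i', t')) := by
    refine congrArg (Quot.lift H.vertexOf ?_) h
    rintro x y (rfl | ⟨-, rfl⟩ | ⟨d, ⟨i, t⟩, ⟨i', t'⟩, ⟨-, h | h⟩, rfl, rfl⟩)
    · exact Quot.sound (Or.inl rfl)
    · exact Quot.sound (Or.inr rfl)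
    · obtain rfl : i = i' := h
      exact H.vertexOf_pt d i t t'
    · exact h.elim
  refine he ?_
  rw [H.vertexOf_pt e i t false, H.vertexOf_pt e i' t' false] at hv
  cases i <;> cases i'
  · exact absurd rfl hne
  · exact hv
  · exact hv.symm
  · exact absurd rfl hne

/-- The two ends of an arrow of a non-loop edge `e` stay connected when `e` is opened. -/
theorem linkMk_compLink_of_fst_eq [Finite P] (he : ¬ H.IsLoop e) (A : Set E)
    {s s' : Bool × Bool} (h : s.1 = s'.1) :
    H.linkMk (openAt (compLink A) e) (H.pt (e, s)) =
      H.linkMk (openAt (compLink A) e) (H.pt (e, s')) :=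
  -- With no edges, the arrows of a non-loop are not joined, so boundary arcs connect the ends of
  -- each arrow; components only grow from `∅` to `A`.
  linkMk_compLink_of_bdryLink (Set.empty_subset A)
    ((linkMk_bdryLink_iff_of_not_joins (not_joins_empty he) s s').2 h)

theorem linkMk_compLink_iff [Finite P] (he : ¬ H.IsLoop e) (A : Set E) (s s' : Bool × Bool) :
    H.linkMk (openAt (compLink A) e) (H.pt (e, s)) =
      H.linkMk (openAt (compLink A) e) (H.pt (e, s')) ↔ s.1 = s'.1 ∨ H.Joins A e := by
  constructor
  · intro h
    by_cases hs : s.1 = s'.1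
    · exact Or.inl hs
    · exact Or.inr ⟨s, s', h, hs⟩
  · rintro (h | ⟨t, t', h, hne⟩)
    · exact linkMk_compLink_of_fst_eq he A h
    · have key : ∀ u, H.linkMk (openAt (compLink A) e) (H.pt (e, u)) =
          H.linkMk (openAt (compLink A) e) (H.pt (e, t)) := by
        intro u
        by_cases hu : u.1 = t.1
        · exact linkMk_compLink_of_fst_eq he A hu
        · refine (linkMk_compLink_of_fst_eq he A ?_).trans h.symm
          revert hu hne
          cases u.1 <;> cases t.1 <;> cases t'.1 <;> simp
      exact (key s).trans (key s').symm

/-- Constant excess at `A` and `insert e A` is the equality case of `linkCard_insert_le`. -/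
theorem Plane.not_crosses_xor [Finite P] [Fintype E] (hH : H.Plane) {A : Set E} (heA : e ∉ A)
    (h : H.Joins A e) : ¬ H.Crosses (openAt (bdryLink A) e) e (fun s => s.1 ^^ s.2) := by
  classical
  have h1 := hH.excess_eq A.toFinset
  have h2 := hH.excess_eq (insert e A.toFinset)
  rw [excess] at h1 h2
  rw [Finset.card_insert_of_notMem (by simpa using heA)] at h2
  simp only [Finset.coe_insert, Set.coe_toFinset] at h1 h2
  push_cast at h2
  exact not_crosses_xor_of_joins heA h (by omega)

theorem Plane.linkMk_bdryLink_iff [Finite P] [Fintype E] (hH : H.Plane) {A : Set E}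
    (heA : e ∉ A) (h : H.Joins A e) (s s' : Bool × Bool) :
    H.linkMk (openAt (bdryLink A) e) (H.pt (e, s)) =
      H.linkMk (openAt (bdryLink A) e) (H.pt (e, s')) ↔ (s.1 ^^ s.2) = (s'.1 ^^ s'.2) :=
  linkMk_bdryLink_iff_of_not_crosses (χ := fun s => s.1 ^^ s.2) (by decide)
    (hH.not_crosses_xor heA h) s s'

theorem Plane.crosses_fst [Finite P] [Fintype E] (hH : H.Plane) {A : Set E}
    (heA : e ∉ A) (h : H.Joins A e) : H.Crosses (openAt (bdryLink A) e) e Prod.fst :=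
  ⟨(false, false), (true, true), (hH.linkMk_bdryLink_iff heA h _ _).2 rfl, by simp⟩

/-! ### Component and boundary counts for `H \ e` and `H / e`. -/

variable (H e)

/-- The number of components of the ribbon subgraph with edge set `A` that avoid the edge `e`. -/
noncomputable def compAvoiding (A : Set E) : ℕ := H.linkCardAvoiding (openAt (compLink A) e) e

/-- The number of boundary components of the ribbon subgraph with edge set `A` that avoid the
arrows of `e`. -/
noncomputable def bdryAvoiding (A : Set E) : ℕ := H.linkCardAvoiding (openAt (bdryLink A) e) e

variable {H e}

theorem not_mem_image_val (A : Set {h : E // h ≠ e}) : e ∉ Subtype.val '' A := by simp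

open Classical in
theorem numComponents_delete_restrict [Finite P] (A : Set {h : E // h ≠ e}) :
    ((H.delete e).restrict A).numComponents =
      H.compAvoiding e (Subtype.val '' A) + if H.Joins (Subtype.val '' A) e then 1 else 2 := by
  rw [numComponents_restrict, linkCard_delete]
  refine H.linkCard_eq_of_colour e
    ((openAt_extendLinkBy _ _).trans (extendLink_compLink A)) Prod.fst Prod.fst_surjective ?_ ?_
  · rintro s s' (⟨h, -⟩ | ⟨-, rfl⟩)
    · exact absurd rfl h
    · rfl
  · intro s s' h
    have : s = s' ∨ s' = (s.1, !s.2) := by revert s s'; decide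
    exact this.imp_right fun h => Or.inr ⟨rfl, h⟩

theorem numComponents_contract_restrict [Finite P] (he : ¬ H.IsLoop e)
    (A : Set {h : E // h ≠ e}) :
    ((H.contract e).restrict A).numComponents = H.compAvoiding e (Subtype.val '' A) + 1 := by
  classical
  rw [numComponents_restrict, linkCard_contract]
  refine (H.linkCard_eq_of_colour e
    ((openAt_extendLinkBy _ _).trans (extendLink_compLink A)) _ surjective_xor ?_ ?_).trans ?_
  · rintro s s' (⟨h, -⟩ | ⟨-, rfl⟩)
    · exact absurd rfl h
    · simp
  · intro s s' h
    have : s = s' ∨ s' = (!s.1, !s.2) := by revert s s'; decide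
    exact this.imp_right fun h => Or.inr ⟨rfl, h⟩
  · rw [if_pos]
    · rfl
    -- The two ends of one arrow are connected and have different xor colours.
    · exact ⟨(false, false), (false, true), linkMk_compLink_of_fst_eq he _ rfl, by simp⟩

open Classical in
theorem Plane.numBoundary_delete_restrict [Finite P] [Fintype E] (hH : H.Plane)
    (A : Set {h : E // h ≠ e}) :
    ((H.delete e).restrict A).numBoundary =
      H.bdryAvoiding e (Subtype.val '' A) + if H.Joins (Subtype.val '' A) e then 1 else 2 := by
  rw [numBoundary_restrict, linkCard_delete]
  refine (H.linkCard_eq_of_colour e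
    ((openAt_extendLinkBy _ _).trans (extendLink_bdryLink A)) Prod.fst Prod.fst_surjective
      ?_ ?_).trans ?_
  · rintro s s' (⟨h, -⟩ | ⟨-, rfl⟩)
    · exact absurd rfl h
    · rfl
  · intro s s' h
    have : s = s' ∨ s' = (s.1, !s.2) := by revert s s'; decide
    exact this.imp_right fun h => Or.inr ⟨rfl, h⟩
  · by_cases h : H.Joins (Subtype.val '' A) e
    · rw [if_pos h, if_pos (hH.crosses_fst (not_mem_image_val A) h)]
      rfl
    · rw [if_neg h, if_neg (not_crosses_of_not_joins h)]
      rfl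

-- The counts 2 and 1 are exchanged compared with deletion, because contraction links the ends as
-- the band does.
open Classical in
theorem Plane.numBoundary_contract_restrict [Finite P] [Fintype E] (hH : H.Plane)
    (A : Set {h : E // h ≠ e}) :
    ((H.contract e).restrict A).numBoundary =
      H.bdryAvoiding e (Subtype.val '' A) + if H.Joins (Subtype.val '' A) e then 2 else 1 := by
  rw [numBoundary_restrict, linkCard_contract]
  refine (H.linkCard_eq_of_colour e
    ((openAt_extendLinkBy _ _).trans (extendLink_bdryLink A)) _ surjective_xor ?_ ?_).trans ?_
  · rintro s s' (⟨h, -⟩ | ⟨-, rfl⟩)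
    · exact absurd rfl h
    · simp
  · intro s s' h
    have : s = s' ∨ s' = (!s.1, !s.2) := by revert s s'; decide
    exact this.imp_right fun h => Or.inr ⟨rfl, h⟩
  · by_cases h : H.Joins (Subtype.val '' A) e
    · rw [if_pos h, if_neg (hH.not_crosses_xor (not_mem_image_val A) h)]
      rfl
    · rw [if_neg h, if_pos (crosses_xor_of_not_joins h)]
      rfl

/-- Among the sets of edges that do not join the arrows of `e`, only the empty set has its numbers
of components and boundary components. -/
theorem Plane.eq_empty_of_avoiding_eq [Finite P] [Fintype E] (hH : H.Plane) (he : ¬ H.IsLoop e)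
    {A : Set E} (heA : e ∉ A) (h : ¬ H.Joins A e)
    (hk : H.compAvoiding e A = H.compAvoiding e ∅)
    (hb : H.bdryAvoiding e A = H.bdryAvoiding e ∅) : A = ∅ := by
  classical
  have h1 := hH.excess_eq A.toFinset
  have h2 := hH.excess_eq ∅
  have he0 : e ∉ (∅ : Set E) := id
  simp only [excess, Set.coe_toFinset, Finset.coe_empty, Finset.card_empty,
    H.linkCard_bdryLink_of_not_mem e heA, H.linkCard_compLink_of_not_mem e heA,
    H.linkCard_bdryLink_of_not_mem e he0, H.linkCard_compLink_of_not_mem e he0,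
    if_neg h, if_neg (not_crosses_of_not_joins h), if_neg (not_joins_empty he),
    if_neg (not_crosses_of_not_joins (not_joins_empty he))] at h1 h2
  rw [compAvoiding, compAvoiding] at hk
  rw [bdryAvoiding, bdryAvoiding] at hb
  -- The excess is constant, so equal k and b leave |A| = 0.
  have h3 : A.toFinset.card = 0 := by omega
  exact Set.toFinset_eq_empty.1 (Finset.card_eq_zero.1 h3)

end

/-! ### Component and boundary counts for the tensor product. -/

section

variable {E P E' P' : Type*} {G : ArrowPresentation E P} {H : ArrowPresentation E' P'} {e : E'}

/-- Each copy links the ends of `d` either by arrow or all together, which is `compLink` for the set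
of joined edges. -/
theorem numComponents_tensor_restrict [Fintype E] [Finite P] [Finite P'] (he : ¬ H.IsLoop e)
    (φ : E → Equiv.Perm Bool) (B : Set (E × {h : E' // h ≠ e})) :
    ((G.tensor H e φ).restrict B).numComponents =
      ∑ d, H.compAvoiding e (Subtype.val '' {h | (d, h) ∈ B}) +
      (G.restrict {d | H.Joins (Subtype.val '' {h | (d, h) ∈ B}) e}).numComponents := by
  rw [numComponents_restrict, numComponents_restrict,
    G.linkCard_tensor H e φ fun d => extendLink_compLink {h | (d, h) ∈ B}]
  congr 2
  funext d s s'
  exact propext ((linkMk_compLink_iff he _ _ _).trans (by simp [compLink]))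

theorem Plane.numBoundary_tensor_restrict [Fintype E] [Finite P] [Fintype E'] [Finite P']
    (hH : H.Plane) (φ : E → Equiv.Perm Bool) (B : Set (E × {h : E' // h ≠ e})) :
    ((G.tensor H e φ).restrict B).numBoundary =
      ∑ d, H.bdryAvoiding e (Subtype.val '' {h | (d, h) ∈ B}) +
      (G.restrict {d | H.Joins (Subtype.val '' {h | (d, h) ∈ B}) e}).numBoundary := by
  rw [numBoundary_restrict, numBoundary_restrict,
    G.linkCard_tensor H e φ fun d => extendLink_bdryLink {h | (d, h) ∈ B}]
  congr 1
  -- Exchanging the arrows permutes the two xor classes, so the coupling does not affect the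
  -- partition.
  have hφ : ∀ (p : Equiv.Perm Bool) (s s' : Bool × Bool),
      (p s.1 ^^ s.2) = (p s'.1 ^^ s'.2) ↔ (s.1 ^^ s.2) = (s'.1 ^^ s'.2) := by decide
  refine linkCard_congr ?_ ?_
  · intro d s s' h
    by_cases hd : H.Joins (Subtype.val '' {h | (d, h) ∈ B}) e
    · rw [hH.linkMk_bdryLink_iff (not_mem_image_val _) hd, hφ] at h
      have : s = s' ∨ s' = (!s.1, !s.2) := by revert s s'; decide
      rcases this with rfl | h
      · rfl
      · exact G.linkMk_pt (Or.inl ⟨hd, h⟩)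
    · rw [linkMk_bdryLink_iff_of_not_joins hd, EmbeddingLike.apply_eq_iff_eq] at h
      have : s = s' ∨ s' = (s.1, !s.2) := by revert s s'; decide
      rcases this with rfl | h
      · rfl
      · exact G.linkMk_pt (Or.inr ⟨hd, h⟩)
  · rintro d s s' (⟨hd, rfl⟩ | ⟨hd, rfl⟩)
    · refine G.linkMk_pt ((hH.linkMk_bdryLink_iff (not_mem_image_val _) hd _ _).2 ?_)
      rw [hφ (φ d) s (!s.1, !s.2)]
      simp
    · exact G.linkMk_pt ((linkMk_bdryLink_iff_of_not_joins hd _ _).2 rfl)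

end

/-! ### The polynomials as weighted sums over joined and separated sets. -/

section

variable {E P : Type*} [Fintype E] [DecidableEq E] (H : ArrowPresentation E P) (e : E)
  {R : Type*} [CommRing R] (a : R) (b : {h : E // h ≠ e} → R) (c : R)

/-- The contribution of the set `A` of edges to the polynomial, without the components and
boundary components that meet the edge `e`. -/
noncomputable def weightAvoiding (A : Finset {h : E // h ≠ e}) : R :=
  a ^ H.compAvoiding e (Subtype.val '' (A : Set {h : E // h ≠ e})) * (∏ h ∈ A, b h) *
    c ^ H.bdryAvoiding e (Subtype.val '' (A : Set {h : E // h ≠ e}))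

open Classical in
/-- The sum of the weights of the sets of edges that join the two arrows of `e`. -/
noncomputable def joinedSum : R :=
  ∑ A ∈ Finset.univ.filter fun A : Finset {h : E // h ≠ e} =>
      H.Joins (Subtype.val '' (A : Set {h : E // h ≠ e})) e,
    H.weightAvoiding e a b c A

open Classical in
/-- The sum of the weights of the sets of edges that do not join the two arrows of `e`. -/
noncomputable def separatedSum : R :=
  ∑ A ∈ Finset.univ.filter fun A : Finset {h : E // h ≠ e} =>
      ¬ H.Joins (Subtype.val '' (A : Set {h : E // h ≠ e})) e,
    H.weightAvoiding e a b c A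

variable {H e}

/-- Arranged to match the linear system, with `a * c * separatedSum` as g and `a * c * joinedSum` as
f. -/
theorem Plane.multiBR_delete [Finite P] (hH : H.Plane) :
    (H.delete e).multiBR a b c =
      a * c * (a * c * H.separatedSum e a b c) + a * c * H.joinedSum e a b c := by
  classical
  rw [multiBR, separatedSum, joinedSum, Finset.sum_filter, Finset.sum_filter, Finset.mul_sum,
    Finset.mul_sum, Finset.mul_sum, ← Finset.sum_add_distrib]
  refine Finset.sum_congr rfl fun A _ => ?_
  rw [numComponents_delete_restrict, hH.numBoundary_delete_restrict, weightAvoiding]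
  by_cases h : H.Joins (Subtype.val '' (A : Set {h : E // h ≠ e})) e <;> simp only [h, if_true,
    if_false, not_true, not_false_iff] <;> ring

theorem Plane.multiBR_contract [Finite P] (hH : H.Plane) (he : ¬ H.IsLoop e) :
    (H.contract e).multiBR a b c =
      a * c * H.separatedSum e a b c + c * (a * c * H.joinedSum e a b c) := by
  classical
  rw [multiBR, separatedSum, joinedSum, Finset.sum_filter, Finset.sum_filter, Finset.mul_sum,
    Finset.mul_sum, Finset.mul_sum, ← Finset.sum_add_distrib]
  refine Finset.sum_congr rfl fun A _ => ?_
  rw [numComponents_contract_restrict he, hH.numBoundary_contract_restrict, weightAvoiding]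
  by_cases h : H.Joins (Subtype.val '' (A : Set {h : E // h ≠ e})) e <;> simp only [h, if_true,
    if_false, not_true, not_false_iff] <;> ring

/-- As a polynomial in a and c over `S`, the sum has coefficient 1 at the monomial of the empty set,
which no other separated set produces. -/
theorem Plane.separatedSum_ne_zero [Finite P] (hH : H.Plane) (he : ¬ H.IsLoop e)
    {K : Type*} [CommRing K] [Nontrivial K] {S : Subalgebra ℤ K} {a c : K}
    {b : {h : E // h ≠ e} → K} (hb : ∀ h, b h ∈ S) (hac : AlgebraicIndependent S ![a, c]) :
    H.separatedSum e a b c ≠ 0 := by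
  classical
  let x : Finset {h : E // h ≠ e} → Fin 2 →₀ ℕ := fun A =>
    Finsupp.single 0 (H.compAvoiding e (Subtype.val '' (A : Set {h : E // h ≠ e}))) +
    Finsupp.single 1 (H.bdryAvoiding e (Subtype.val '' (A : Set {h : E // h ≠ e})))
  let p : MvPolynomial (Fin 2) S :=
    ∑ A ∈ Finset.univ.filter fun A : Finset {h : E // h ≠ e} =>
      ¬ H.Joins (Subtype.val '' (A : Set {h : E // h ≠ e})) e,
      MvPolynomial.monomial (x A) (∏ h ∈ A, (⟨b h, hb h⟩ : S))
  have hp : MvPolynomial.aeval ![a, c] p = H.separatedSum e a b c := by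
    rw [map_sum, separatedSum]
    refine Finset.sum_congr rfl fun A _ => ?_
    rw [MvPolynomial.aeval_monomial, weightAvoiding,
      Finsupp.prod_add_index' (by simp) (by simp [pow_add]),
      Finsupp.prod_single_index (by simp), Finsupp.prod_single_index (by simp), map_prod]
    simp only [Matrix.cons_val_zero, Matrix.cons_val_one]
    change (∏ h ∈ A, b h) * _ = _
    ring
  have hcoeff : p.coeff (x ∅) = 1 := by
    rw [MvPolynomial.coeff_sum, Finset.sum_eq_single ∅]
    · simp
    · intro A hA hne
      rw [MvPolynomial.coeff_monomial, if_neg]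
      intro hx
      have h0 := DFunLike.congr_fun hx 0
      have h1 := DFunLike.congr_fun hx 1
      simp [x] at h0 h1
      have := hH.eq_empty_of_avoiding_eq he (not_mem_image_val _) (Finset.mem_filter.1 hA).2 h0 h1
      simp at this
      exact hne this
    · intro h
      refine absurd (Finset.mem_filter.2 ⟨Finset.mem_univ _, ?_⟩) h
      simpa using not_joins_empty he
  intro h0
  rw [← hp] at h0
  have := hac.eq_zero_of_aeval_eq_zero _ h0
  rw [this] at hcoeff
  simp at hcoeff

end

section

variable {E P E' P' : Type*} [Fintype E] [Finite P] [Fintype E'] [DecidableEq E'] [Finite P']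
  (G : ArrowPresentation E P) {H : ArrowPresentation E' P'} {e : E'}
  {R : Type*} [CommRing R] (a : R) (b : E × {h : E' // h ≠ e} → R) (c : R)

-- Subsets of the tensor product are grouped by the set `D` of edges whose copy is joined; within a
-- group the weights factor over the copies.
open Classical in
theorem Plane.multiBR_tensor (hH : H.Plane) (he : ¬ H.IsLoop e) (φ : E → Equiv.Perm Bool) :
    (G.tensor H e φ).multiBR a b c =
      ∑ D : Finset E, a ^ (G.restrict (D : Set E)).numComponents *
        (∏ d, if d ∈ D then H.joinedSum e a (fun h => b (d, h)) c
          else H.separatedSum e a (fun h => b (d, h)) c) *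
        c ^ (G.restrict (D : Set E)).numBoundary := by
  let J : Finset {h : E' // h ≠ e} → Prop := fun A =>
    H.Joins (Subtype.val '' (A : Set {h : E' // h ≠ e})) e
  let w : E → Finset {h : E' // h ≠ e} → R := fun d => H.weightAvoiding e a (fun h => b (d, h)) c
  let D : (E → Finset {h : E' // h ≠ e}) → Finset E := fun f => {d | J (f d)}
  -- A set of edges of the tensor product corresponds to its family of slices.
  let φ' : (E → Finset {h : E' // h ≠ e}) ≃ Finset (E × {h : E' // h ≠ e}) :=
    { toFun := fun f => {p | p.2 ∈ f p.1}
      invFun := fun B d => {h | (d, h) ∈ B}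
      left_inv := fun f => by ext; simp
      right_inv := fun B => by ext; simp }
  have hmem : ∀ f d, {h | (d, h) ∈ (φ' f : Set (E × {h : E' // h ≠ e}))} = (f d : Set _) := by
    intro f d
    ext
    simp [φ']
  have hprod : ∀ D₀ : Finset E, (∏ d, if d ∈ D₀ then H.joinedSum e a (fun h => b (d, h)) c
      else H.separatedSum e a (fun h => b (d, h)) c) =
      ∑ f : E → Finset {h : E' // h ≠ e} with D f = D₀, ∏ d, w d (f d) := by
    intro D₀
    have h1 : ∀ d, (if d ∈ D₀ then H.joinedSum e a (fun h => b (d, h)) c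
        else H.separatedSum e a (fun h => b (d, h)) c) = ∑ A with (d ∈ D₀ ↔ J A), w d A := by
      intro d
      by_cases hd : d ∈ D₀
      · simp only [hd, if_true, true_iff]
        rfl
      · simp only [hd, if_false, false_iff]
        rfl
    simp only [h1]
    rw [Finset.prod_univ_sum]
    refine Finset.sum_congr ?_ fun _ _ => rfl
    ext f
    simp [D, Fintype.mem_piFinset, Finset.ext_iff, iff_comm]
  rw [multiBR, ← φ'.sum_comp]
  simp only [hprod, Finset.mul_sum, Finset.sum_mul]
  rw [← Finset.sum_fiberwise Finset.univ D]
  refine Finset.sum_congr rfl fun D₀ _ => ?_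
  refine Finset.sum_congr rfl fun f hf => ?_
  obtain rfl : D f = D₀ := (Finset.mem_filter.1 hf).2
  have hset : {d | H.Joins (Subtype.val ''
      {h | (d, h) ∈ (φ' f : Set (E × {h : E' // h ≠ e}))}) e} =
      ((D f : Finset E) : Set E) := by
    simp only [hmem]
    ext
    simp [D, J]
  rw [numComponents_tensor_restrict he, hH.numBoundary_tensor_restrict, hset]
  simp only [hmem]
  have hb : ∏ p ∈ φ' f, b p = ∏ d, ∏ h ∈ f d, b (d, h) :=
    Finset.prod_finset_product _ _ _ (by simp [φ'])
  rw [hb]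
  simp only [w, weightAvoiding, Finset.prod_mul_distrib, Finset.prod_pow_eq_pow_sum]
  ring

end

end ArrowPresentation

/-! ### The theorem. -/

theorem mainTheorem10 {E P E' P' K : Type*} [Fintype E] [Finite P] [Fintype E'] [DecidableEq E']
    [Finite P'] [Field K]
    (G : ArrowPresentation E P) (hG : G.Orientable)
    (H : ArrowPresentation E' P') (hH : H.Plane)
    (e : E') (he : ¬ H.IsLoop e)
    (φ : E → Equiv.Perm Bool)
    (a c : K) (b : E × {h : E' // h ≠ e} → K)
    (ha : a ≠ 0) (hc : c ≠ 0) (hac : a * c ^ 2 ≠ 1) :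
    (∀ d : E, ∃! s : K × K,
      a * c * s.2 + s.1 = (H.delete e).multiBR a (fun h => b (d, h)) c ∧
      s.2 + c * s.1 = (H.contract e).multiBR a (fun h => b (d, h)) c) ∧
    ∀ f g : E → K,
      (∀ d : E,
        a * c * g d + f d = (H.delete e).multiBR a (fun h => b (d, h)) c ∧
        g d + c * f d = (H.contract e).multiBR a (fun h => b (d, h)) c) →
      (AlgebraicIndependent (Algebra.adjoin ℤ (Set.range b)) ![a, c] → ∀ d, g d ≠ 0) ∧
      ((∀ d, g d ≠ 0) →
        (G.tensor H e φ).multiBR a b c =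
          ((a * c) ^ Fintype.card E)⁻¹ * (∏ d, g d) * G.multiBR a (fun d => f d / g d) c) := by
  classical
  have hac0 : a * c ≠ 0 := mul_ne_zero ha hc
  have huniq : ∀ {x y x' y' : K}, a * c * y + x = a * c * y' + x' → y + c * x = y' + c * x' →
      x = x' ∧ y = y' := by
    intro x y x' y' h1 h2
    -- Up to sign, 1 - ac² is the determinant of the system.
    have h3 : (1 - a * c ^ 2) * (x - x') = 0 := by linear_combination h1 - a * c * h2
    have hx : x = x' := sub_eq_zero.1
      ((mul_eq_zero.1 h3).resolve_left (sub_ne_zero.2 (Ne.symm hac)))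
    subst hx
    exact ⟨rfl, by simpa using h2⟩
  have hdel := fun d => hH.multiBR_delete (e := e) a (fun h => b (d, h)) c
  have hcon := fun d => hH.multiBR_contract (e := e) a (fun h => b (d, h)) c he
  refine ⟨fun d => ⟨(_, _), ⟨(hdel d).symm, (hcon d).symm⟩, ?_⟩, fun f g hfg => ?_⟩
  · rintro ⟨x, y⟩ ⟨h1, h2⟩
    obtain ⟨hx, hy⟩ := huniq (h1.trans (hdel d)) (h2.trans (hcon d))
    exact Prod.ext hx hy
  · have hf : ∀ d, f d = a * c * H.joinedSum e a (fun h => b (d, h)) c := fun d =>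
      (huniq ((hfg d).1.trans (hdel d)) ((hfg d).2.trans (hcon d))).1
    have hg : ∀ d, g d = a * c * H.separatedSum e a (fun h => b (d, h)) c := fun d =>
      (huniq ((hfg d).1.trans (hdel d)) ((hfg d).2.trans (hcon d))).2
    refine ⟨fun hind d => ?_, fun hg0 => ?_⟩
    · rw [hg d]
      exact mul_ne_zero hac0 (hH.separatedSum_ne_zero he
        (fun h => Algebra.subset_adjoin (Set.mem_range_self (d, h))) hind)
    · rw [hH.multiBR_tensor G a b c he φ, ArrowPresentation.multiBR, Finset.mul_sum]
      refine Finset.sum_congr rfl fun D _ => ?_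
      -- Each edge contributes (ac)⁻¹f if it is in `D` and (ac)⁻¹g if not; pulling out g everywhere
      -- leaves f/g on `D`.
      have hprod : (∏ d, if d ∈ D then H.joinedSum e a (fun h => b (d, h)) c
          else H.separatedSum e a (fun h => b (d, h)) c) =
          ((a * c) ^ Fintype.card E)⁻¹ * (∏ d, g d) * ∏ d ∈ D, f d / g d := by
        have h1 : ((a * c) ^ Fintype.card E)⁻¹ = ∏ _d : E, (a * c)⁻¹ := by
          rw [Finset.prod_const, Finset.card_univ, inv_pow]
        have h2 : ∏ d ∈ D, f d / g d = ∏ d, if d ∈ D then f d / g d else 1 := by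
          rw [Finset.prod_ite_mem, Finset.univ_inter]
        rw [h1, h2, ← Finset.prod_mul_distrib, ← Finset.prod_mul_distrib]
        refine Finset.prod_congr rfl fun d _ => ?_
        split_ifs
        · rw [mul_assoc, mul_div_cancel₀ _ (hg0 d), hf d, inv_mul_cancel_left₀ hac0]
        · rw [mul_one, hg d, inv_mul_cancel_left₀ hac0]
      rw [hprod]
      ring
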